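/- Let $T:[0,1]\to[0,1]$ be the doubling map, $Tx=2x$ for $x\in[0,1/2]$ and $Tx=2x-1$ for $x\in(1/2,1]$. For $0<a<b<1$ put $$\mathcal J(a,b)=\{x\in[0,1] : T^nx\notin(a,b)\text{ for all } n\ge 0\},$$ and for $a\in(1/4,1/2)$ put $$\phi(a)=\sup\{b\in(a,1) : \mathcal J(a,b)\ne\{0,1\}\},\qquad \chi(a)=\sup\{b\in(a,1) : \mathcal J(a,b)\text{ is uncountable}\}.$$ A finite $0$-$1$ word $w$ is called balanced if the numbers of $1$s in any two factors (blocks of consecutive letters) of $w$ of equal length differ by at most $1$, and cyclically balanced if $ww$ is balanced. For a rational $r=p/q\in(0,1)$ in lowest terms, let $\omega_r^-$ be the lexicographically largest cyclically balanced word of length $q$ with exactly $p$ $1$s that begins with $0$, and let $\omega_r^+$ be the lexicographically smallest cyclically balanced word of length $q$ with exactly $p$ $1$s that begins with $1$. Identifying infinite $0$-$1$ words with the real numbers in $[0,1]$ of which they are binary expansions, and writing $u^\infty=uuu\cdots$, put $$\Delta(r)=\bigl[(\omega_r^-)^\infty,\ \omega_r^-(\omega_r^+)^\infty\bigr],\qquad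 \mathcal S=(1/4,1/2)\setminus\bigcup_{r\in\mathbb Q\cap(0,1)}\Delta(r).$$ Then for every $a\in(1/4,1/2)$ one has $\phi(a)=\chi(a)$ if and only if $a\in\mathcal S$. Moreover, the set $\mathcal S$ has Hausdorff dimension zero. -/

import Mathlib

namespace DoublingHole

open Set

/-- The doubling map of `[0,1]`, with `T (1/2) = 1`. Only its values on `[0,1]` matter. -/
noncomputable def T (x : ℝ) : ℝ := if x ≤ 1 / 2 then 2 * x else 2 * x - 1

/-- The points of `[0,1]` whose forward orbit (including the point itself) avoids the
open hole `(a,b)`. -/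
def J (a b : ℝ) : Set ℝ := {x | x ∈ Icc (0 : ℝ) 1 ∧ ∀ n : ℕ, T^[n] x ∉ Ioo a b}

/-- Supremum of the right ends `b` of holes `(a,b)`, `a < b < 1`, that are avoided by some
orbit other than the two fixed points. -/
noncomputable def phi (a : ℝ) : ℝ := sSup {b : ℝ | a < b ∧ b < 1 ∧ J a b ≠ {0, 1}}

/-- Supremum of the right ends `b` of holes `(a,b)`, `a < b < 1`, with uncountable `J a b`. -/
noncomputable def chi (a : ℝ) : ℝ := sSup {b : ℝ | a < b ∧ b < 1 ∧ ¬ (J a b).Countable}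

/-- Finite words over `{0,1}` are lists of Booleans (`false` is `0`, `true` is `1`). A word is
balanced if the numbers of ones in any two factors of equal length differ by at most one. -/
def Balanced (w : List Bool) : Prop :=
  ∀ u v : List Bool, u <:+: w → v <:+: w → u.length = v.length →
    |(u.count true : ℤ) - (v.count true : ℤ)| ≤ 1

/-- A finite word is cyclically balanced if its square is balanced. -/
def CyclicallyBalanced (w : List Bool) : Prop := Balanced (w ++ w)

/-- Cyclically balanced words with first letter `c`, whose length is the denominator of `r` in
lowest terms and whose proportion of ones is `r`. -/
def ratioWords (r : ℚ) (c : Bool) : Set (List Bool) :=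
  {w | w.length = r.den ∧ (w.count true : ℚ) / (w.length : ℚ) = r ∧
    CyclicallyBalanced w ∧ w.head? = some c}

/-- The lexicographically largest element of `ratioWords r 0`. (For rational `0 < r < 1` this set
is finite and nonempty, so the word exists; it is unique because the order is linear.) -/
noncomputable def omegaMinus (r : ℚ) : List Bool :=
  Classical.epsilon fun w => IsGreatest (ratioWords r false) w

/-- The lexicographically smallest element of `ratioWords r 1`. -/
noncomputable def omegaPlus (r : ℚ) : List Bool :=
  Classical.epsilon fun w => IsLeast (ratioWords r true) w

/-- The infinite periodic word `u u u …`. -/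
def periodic (u : List Bool) : ℕ → Bool := fun n => u.getD (n % u.length) false

/-- The concatenation of a finite word and an infinite word. -/
def concat (u : List Bool) (x : ℕ → Bool) : ℕ → Bool :=
  fun n => if n < u.length then u.getD n false else x (n - u.length)

/-- The real number with binary expansion `0.x₀x₁x₂…`. -/
noncomputable def value (x : ℕ → Bool) : ℝ :=
  ∑' n : ℕ, (if x n then (1 : ℝ) else 0) / 2 ^ (n + 1)

/-- The closed interval from `ω⁻ω⁻ω⁻…` to `ω⁻ω⁺ω⁺ω⁺…`, where `ω⁻`, `ω⁺` are the two extremal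
words of ratio `r`. -/
noncomputable def Delta (r : ℚ) : Set ℝ :=
  Icc (value (periodic (omegaMinus r)))
    (value (concat (omegaMinus r) (periodic (omegaPlus r))))

/-- The exceptional set: the complement in `(1/4,1/2)` of all the intervals `Delta r`. -/
noncomputable def exceptionalSet : Set ℝ :=
  Ioo (1 / 4 : ℝ) (1 / 2) \ ⋃ r ∈ Ioo (0 : ℚ) 1, Delta r

end DoublingHole

namespace DoublingHole

open Set Filter Topology

/-! ### Infinite words and their lexicographic order -/

/-! Points are coded by their binary itineraries. When a < 1/2 < b, avoiding (a,b) means that every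
suffix beginning with 0 is at most a and every suffix beginning with 1 is at least b. This
lexicographic condition is self-similar under the substitutions c ↦ c, !c ↦ (!c)c. A list `d` of
Booleans is a node of a binary tree and codes a composition σ of such substitutions.

Three facts hold at each node. If a lies in [σ((01)^∞), σ(01(10)^∞)], the periodic orbit of
σ((01)^∞) gives phi(a) ≥ σ((10)^∞). On the other hand, every orbit avoiding a hole whose right end
exceeds σ(1001(10)^∞) is fixed or eventually lands on that periodic orbit, so chi(a) ≤
σ(1001(10)^∞), which is strictly smaller (`periodic_le_phi`, `chi_le`, `chi_lt_phi`). If a lies in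
the gap (σ(010^∞), σ(01^∞)), then σ(10^∞) ≤ chi(a) ≤ phi(a) ≤ σ(101^∞), and the outer bounds agree
on the block σ(10) (`InGap.le_chi`, `phi_le`). The upper bounds rest on desubstitution,
`exists_substs_eq`.

The intervals of the first kind are exactly the Δ(r). The words σ(01) and σ(10) have extremal prefix
counts for their slope, which makes them ω⁻ and ω⁺ (`isGreatest_node`, `isLeast_node`), and the
Euclidean algorithm reaches every rational slope (`exists_ratio`). Removing Δ from the gap of a node
leaves the gaps of its two children (`InGap.child`). A point of the exceptional set therefore lies
in gaps of nodes with arbitrarily long words, so phi and chi agree there.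

For the dimension, the gaps of nodes with word length between N and 2N cover the set. Each has
diameter at most 2^(-N), and a node is determined by the lengths of its two words, so at most
(2N+1)² gaps are needed: polynomially many sets of exponentially small size. -/

/-- The infinite word `b x₀ x₁ …`. -/
def cons (b : Bool) (x : ℕ → Bool) : ℕ → Bool
  | 0 => b
  | n + 1 => x n

/-- The suffix of `x` starting at position `k`. -/
def shift (k : ℕ) (x : ℕ → Bool) : ℕ → Bool := fun n => x (n + k)

/-- The constant infinite word. -/
def rep (b : Bool) : ℕ → Bool := fun _ => b

/-- The alternating infinite word with first letter `b`. -/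
def alt (b : Bool) : ℕ → Bool
  | 0 => b
  | n + 1 => !(alt b n)

/-- Both letters occur infinitely often. -/
def NotEventuallyConst (x : ℕ → Bool) : Prop := ∀ b n, ∃ m, n ≤ m ∧ x m = b

@[simp] lemma cons_zero (b : Bool) (x : ℕ → Bool) : cons b x 0 = b := rfl
@[simp] lemma cons_succ (b : Bool) (x : ℕ → Bool) (n : ℕ) : cons b x (n + 1) = x n := rfl
lemma shift_apply (k : ℕ) (x : ℕ → Bool) (n : ℕ) : shift k x n = x (n + k) := rfl
@[simp] lemma shift_apply_zero (k : ℕ) (x : ℕ → Bool) : shift k x 0 = x k := by simp [shift]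
@[simp] lemma shift_zero (x : ℕ → Bool) : shift 0 x = x := rfl
@[simp] lemma shift_succ_cons (k : ℕ) (b : Bool) (x : ℕ → Bool) :
    shift (k + 1) (cons b x) = shift k x := rfl
lemma shift_shift (k l : ℕ) (x : ℕ → Bool) : shift k (shift l x) = shift (k + l) x := by
  funext n; simp [shift, add_assoc]
@[simp] lemma shift_rep (k : ℕ) (b : Bool) : shift k (rep b) = rep b := rfl

lemma cons_eta (x : ℕ → Bool) : cons (x 0) (shift 1 x) = x := by
  funext n; cases n <;> rfl

lemma shift_eq_cons (k : ℕ) (x : ℕ → Bool) : shift k x = cons (x k) (shift (k + 1) x) := by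
  funext n
  cases n with
  | zero => simp
  | succ n => simp [shift]; congr 1; omega

lemma exists_cons (x : ℕ → Bool) : ∃ b y, x = cons b y := ⟨x 0, shift 1 x, (cons_eta x).symm⟩

lemma rep_eq_cons (b : Bool) : rep b = cons b (rep b) := by funext n; cases n <;> rfl

lemma alt_not (b : Bool) (n : ℕ) : alt (!b) n = !(alt b n) := by
  induction n with
  | zero => rfl
  | succ n ih => simp [alt, ih]

lemma alt_eq_cons (b : Bool) : alt b = cons b (alt !b) := by
  funext n
  cases n with
  | zero => rfl
  | succ n => simp [alt, alt_not]

lemma alt_eq_cons_cons (b : Bool) : alt b = cons b (cons (!b) (alt b)) := by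
  conv_lhs => rw [alt_eq_cons b, alt_eq_cons (!b), Bool.not_not]

lemma shift_two_alt (b : Bool) : shift 2 (alt b) = alt b := by
  conv_lhs => rw [alt_eq_cons_cons]
  rfl

lemma seq_lt_iff {x y : ℕ → Bool} :
    toLex x < toLex y ↔ ∃ i, (∀ j < i, x j = y j) ∧ x i < y i := Iff.rfl

lemma seq_not_lt {x y : ℕ → Bool} : ¬ toLex x < toLex y ↔ toLex y ≤ toLex x := not_lt

lemma cons_lt_cons {b : Bool} {x y : ℕ → Bool} :
    toLex (cons b x) < toLex (cons b y) ↔ toLex x < toLex y := by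
  simp only [seq_lt_iff]
  constructor
  · rintro ⟨i, h1, h2⟩
    cases i with
    | zero => simp at h2
    | succ i => exact ⟨i, fun j hj => h1 (j + 1) (by omega), h2⟩
  · rintro ⟨i, h1, h2⟩
    refine ⟨i + 1, fun j hj => ?_, h2⟩
    cases j with
    | zero => rfl
    | succ j => exact h1 j (by omega)

lemma cons_le_cons {b : Bool} {x y : ℕ → Bool} :
    toLex (cons b x) ≤ toLex (cons b y) ↔ toLex x ≤ toLex y := by
  rw [← seq_not_lt, cons_lt_cons, seq_not_lt]

lemma lt_of_head {x y : ℕ → Bool} (hx : x 0 = false) (hy : y 0 = true) : toLex x < toLex y :=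
  seq_lt_iff.2 ⟨0, by simp, by simp [hx, hy]⟩

lemma head_true_of_le {x y : ℕ → Bool} (h : toLex x ≤ toLex y) (hx : x 0 = true) :
    y 0 = true := by
  by_contra hy
  exact absurd (lt_of_head (by simpa using hy) hx) (not_lt.2 h)

lemma head_false_of_le {x y : ℕ → Bool} (h : toLex x ≤ toLex y) (hy : y 0 = false) :
    x 0 = false := by
  by_contra hx
  exact absurd (lt_of_head hy (by simpa using hx)) (not_lt.2 h)

lemma rep_false_le (x : ℕ → Bool) : toLex (rep false) ≤ toLex x := by
  rw [← seq_not_lt, seq_lt_iff]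
  rintro ⟨i, -, h⟩
  simp [rep, Bool.lt_iff] at h

lemma le_rep_true (x : ℕ → Bool) : toLex x ≤ toLex (rep true) := by
  rw [← seq_not_lt, seq_lt_iff]
  rintro ⟨i, -, h⟩
  simp [rep, Bool.lt_iff] at h

/-! ### The substitutions `c ↦ c`, `!c ↦ (!c) c` -/

/-- The image of an infinite word under the substitution `c ↦ c`, `!c ↦ (!c) c`. -/
def subst (c : Bool) (x : ℕ → Bool) : ℕ → Bool
  | 0 => x 0
  | 1 => if x 0 = c then x 1 else c
  | n + 2 => if x 0 = c then subst c (shift 1 x) (n + 1) else subst c (shift 1 x) n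

lemma subst_cons_self (c : Bool) (x : ℕ → Bool) : subst c (cons c x) = cons c (subst c x) := by
  funext n
  match n with
  | 0 => simp [subst]
  | 1 => simp [subst]
  | n + 2 => simp [subst]

lemma subst_cons_not (c : Bool) (x : ℕ → Bool) :
    subst c (cons (!c) x) = cons (!c) (cons c (subst c x)) := by
  funext n
  match n with
  | 0 => simp [subst]
  | 1 => simp [subst]
  | n + 2 => simp [subst]

@[simp] lemma subst_apply_zero (c : Bool) (x : ℕ → Bool) : subst c x 0 = x 0 := by simp [subst]

lemma subst_false_cons_true (x : ℕ → Bool) :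
    subst false (cons true x) = cons true (cons false (subst false x)) := subst_cons_not false x
lemma subst_true_cons_false (x : ℕ → Bool) :
    subst true (cons false x) = cons false (cons true (subst true x)) := subst_cons_not true x

/-- The image of each letter begins with that letter, so the first discrepancy of x and y becomes
the first discrepancy of their images. -/
lemma subst_strictMono (c : Bool) {x y : ℕ → Bool} (h : toLex x < toLex y) :
    toLex (subst c x) < toLex (subst c y) := by
  obtain ⟨i, h1, h2⟩ := seq_lt_iff.1 h
  clear h
  induction i generalizing x y with
  | zero =>
    simp only [Bool.lt_iff] at h2
    exact lt_of_head (by simp [h2.1]) (by simp [h2.2])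
  | succ i ih =>
    obtain ⟨b, x, rfl⟩ := exists_cons x
    obtain ⟨b', y, rfl⟩ := exists_cons y
    have hb : b = b' := h1 0 (by omega)
    subst hb
    have := ih (x := x) (y := y) (fun j hj => h1 (j + 1) (by omega)) h2
    by_cases hc : b = c
    · rw [hc, subst_cons_self, subst_cons_self, cons_lt_cons]; exact this
    · have hc : b = !c := by cases b <;> cases c <;> simp_all
      rw [hc, subst_cons_not, subst_cons_not, cons_lt_cons, cons_lt_cons]; exact this

lemma subst_lt_iff (c : Bool) {x y : ℕ → Bool} :
    toLex (subst c x) < toLex (subst c y) ↔ toLex x < toLex y := by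
  refine ⟨fun h => ?_, subst_strictMono c⟩
  rcases lt_trichotomy (toLex x) (toLex y) with h' | h' | h'
  · exact h'
  · rw [toLex.injective h'] at h; exact absurd h (lt_irrefl _)
  · exact absurd h (subst_strictMono c h').not_gt

lemma subst_le_iff (c : Bool) {x y : ℕ → Bool} :
    toLex (subst c x) ≤ toLex (subst c y) ↔ toLex x ≤ toLex y := by
  rw [← seq_not_lt, subst_lt_iff, seq_not_lt]

/-- A cut falls either between two letter images or in the middle of a block (!c)c, leaving a stray
c in front. -/
lemma shift_subst (c : Bool) (x : ℕ → Bool) (m : ℕ) :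
    ∃ n, shift m (subst c x) = subst c (shift n x) ∨
      shift m (subst c x) = cons c (subst c (shift n x)) := by
  induction m using Nat.strong_induction_on generalizing x with
  | _ m ih =>
    obtain ⟨b, x, rfl⟩ := exists_cons x
    match m, ih with
    | 0, _ => exact ⟨0, Or.inl rfl⟩
    | m + 1, ih =>
      by_cases hc : b = c
      · obtain ⟨n, hn⟩ := ih m (by omega) x
        refine ⟨n + 1, ?_⟩
        rw [hc, subst_cons_self]; exact hn
      · have hc : b = !c := by cases b <;> cases c <;> simp_all
        rw [hc, subst_cons_not]
        match m, ih with
        | 0, _ => exact ⟨1, Or.inr rfl⟩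
        | m + 1, ih =>
          obtain ⟨n, hn⟩ := ih m (by omega) x
          exact ⟨n + 1, hn⟩

lemma subst_shift (c : Bool) (x : ℕ → Bool) (n : ℕ) :
    ∃ m, n ≤ m ∧ shift m (subst c x) = subst c (shift n x) := by
  induction n generalizing x with
  | zero => exact ⟨0, le_rfl, rfl⟩
  | succ n ih =>
    obtain ⟨b, x, rfl⟩ := exists_cons x
    obtain ⟨m, hm, h⟩ := ih x
    by_cases hc : b = c
    · exact ⟨m + 1, by omega, by rw [hc, subst_cons_self]; exact h⟩
    · have hc : b = !c := by cases b <;> cases c <;> simp_all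
      exact ⟨m + 2, by omega, by rw [hc, subst_cons_not]; exact h⟩

lemma subst_isolated (c : Bool) (x : ℕ → Bool) (n : ℕ) (h : subst c x n = !c) :
    subst c x (n + 1) = c := by
  obtain ⟨k, hk | hk⟩ := shift_subst c x n
  · have h0 := congrFun hk 0
    have h1 := congrFun hk 1
    obtain ⟨b, y, hy⟩ := exists_cons (shift k x)
    rw [hy] at h0 h1
    simp only [shift_apply_zero, h, subst_apply_zero, cons_zero] at h0
    rw [← h0, subst_cons_not] at h1
    simpa [shift, add_comm] using h1
  · have h0 := congrFun hk 0
    rw [shift_apply_zero, h] at h0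
    simp at h0

/-- The preimage of an infinite word under `subst c`. -/
def desubst (c : Bool) (y : ℕ → Bool) : ℕ → Bool
  | 0 => y 0
  | n + 1 => if y 0 = c then desubst c (shift 1 y) n else desubst c (shift 2 y) n

lemma subst_desubst (c : Bool) (y : ℕ → Bool) (h : ∀ n, y n = (!c) → y (n + 1) = c) :
    subst c (desubst c y) = y := by
  funext n
  induction n using Nat.strong_induction_on generalizing y with
  | _ n ih =>
    have h' : ∀ k n, shift k y n = (!c) → shift k y (n + 1) = c := by
      intro k n hn
      have := h (n + k) hn
      rw [show n + k + 1 = n + 1 + k by omega] at this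
      exact this
    obtain ⟨b, z, rfl⟩ := exists_cons y
    by_cases hc : b = c
    · have : desubst c (cons b z) = cons c (desubst c z) := by
        funext n; cases n <;> simp [desubst, hc]
      rw [this, subst_cons_self]
      cases n with
      | zero => simp [hc]
      | succ n => exact ih n (by omega) z (h' 1)
    · have hb : b = !c := by cases b <;> cases c <;> simp_all
      have : desubst c (cons b z) = cons (!c) (desubst c (shift 1 z)) := by
        funext n; cases n <;> simp [desubst, hb]
      rw [this, subst_cons_not]
      match n, ih with
      | 0, _ => simp [hb]
      | 1, _ => simpa using (h 0 hb).symm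
      | n + 2, ih =>
        have := ih n (by omega) (shift 1 z) (h' 2)
        simpa [shift] using this

lemma notEventuallyConst_subst (c : Bool) {x : ℕ → Bool} (h : NotEventuallyConst x) :
    NotEventuallyConst (subst c x) := by
  intro b n
  obtain ⟨m, hm, hb⟩ := h b n
  obtain ⟨k, hk, e⟩ := subst_shift c x m
  refine ⟨k, by omega, ?_⟩
  rw [← shift_apply_zero k (subst c x), e]; simpa using hb

lemma notEventuallyConst_shift (k : ℕ) {x : ℕ → Bool} (h : NotEventuallyConst x) :
    NotEventuallyConst (shift k x) := by
  intro b n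
  obtain ⟨m, hm, hb⟩ := h b (n + k)
  exact ⟨m - k, by omega, by rw [shift_apply, Nat.sub_add_cancel (by omega)]; exact hb⟩

lemma notEventuallyConst_alt (b : Bool) : NotEventuallyConst (alt b) := by
  intro c n
  by_cases h : alt b n = c
  · exact ⟨n, le_rfl, h⟩
  · exact ⟨n + 1, by omega, by simp only [alt]; cases c <;> simp_all⟩

lemma notEventuallyConst_cons {b : Bool} {x : ℕ → Bool} (h : NotEventuallyConst x) :
    NotEventuallyConst (cons b x) := by
  intro c n
  obtain ⟨m, hm, hb⟩ := h c n
  exact ⟨m + 1, by omega, hb⟩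

/-! ### Compositions of the substitutions -/

/-- The composition of the substitutions `subst c`, `c ∈ d`, the head of `d` being applied last. -/
def substs (d : List Bool) (x : ℕ → Bool) : ℕ → Bool := d.foldr subst x

@[simp] lemma substs_nil (x : ℕ → Bool) : substs [] x = x := rfl
@[simp] lemma substs_cons (c : Bool) (d : List Bool) (x : ℕ → Bool) :
    substs (c :: d) x = subst c (substs d x) := rfl
lemma substs_append (d e : List Bool) (x : ℕ → Bool) :
    substs (d ++ e) x = substs d (substs e x) := by simp [substs]

@[simp] lemma substs_apply_zero (d : List Bool) (x : ℕ → Bool) : substs d x 0 = x 0 := by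
  induction d with
  | nil => rfl
  | cons c d ih => simpa using ih

lemma substs_lt_iff (d : List Bool) {x y : ℕ → Bool} :
    toLex (substs d x) < toLex (substs d y) ↔ toLex x < toLex y := by
  induction d with
  | nil => rfl
  | cons c d ih => rw [substs_cons, substs_cons, subst_lt_iff, ih]

lemma substs_le_iff (d : List Bool) {x y : ℕ → Bool} :
    toLex (substs d x) ≤ toLex (substs d y) ↔ toLex x ≤ toLex y := by
  rw [← seq_not_lt, substs_lt_iff, seq_not_lt]

lemma substs_injective (d : List Bool) : Function.Injective (substs d) := by
  intro x y h
  apply toLex.injective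
  apply le_antisymm
  · rw [← substs_le_iff d, h]
  · rw [← substs_le_iff d, h]

lemma notEventuallyConst_substs (d : List Bool) {x : ℕ → Bool} (h : NotEventuallyConst x) :
    NotEventuallyConst (substs d x) := by
  induction d with
  | nil => exact h
  | cons c d ih => exact notEventuallyConst_subst c ih

lemma substs_shift (d : List Bool) (x : ℕ → Bool) (n : ℕ) :
    ∃ m, n ≤ m ∧ shift m (substs d x) = substs d (shift n x) := by
  induction d with
  | nil => exact ⟨n, le_rfl, rfl⟩
  | cons c d ih =>
    obtain ⟨m, hm, e⟩ := ih
    obtain ⟨k, hk, e'⟩ := subst_shift c (substs d x) m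
    exact ⟨k, by omega, by rw [substs_cons, e', e]; rfl⟩

/-- The bounds must cover all suffixes, whatever their first letter, for the induction to run. A cut
inside a block puts an extra c in front, so only the bound beginning with c changes its form. -/
lemma exists_bounds_substs (d : List Bool) {x lo hi : ℕ → Bool} (hlo : lo 0 = false)
    (hhi : hi 0 = true)
    (h : ∀ n, toLex lo ≤ toLex (shift n x) ∧ toLex (shift n x) ≤ toLex hi) :
    ∃ lo' hi' : ℕ → Bool, lo' 0 = false ∧ hi' 0 = true ∧
      (∀ n, toLex lo' ≤ toLex (shift n (substs d x)) ∧
        toLex (shift n (substs d x)) ≤ toLex hi') ∧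
      cons false hi' = substs d (cons false hi) ∧ cons true lo' = substs d (cons true lo) := by
  induction d with
  | nil => exact ⟨lo, hi, hlo, hhi, h, rfl, rfl⟩
  | cons c d ih =>
    obtain ⟨l, u, hl, hu, hb, e0, e1⟩ := ih
    cases c with
    | false =>
      refine ⟨cons false (subst false l), subst false u, rfl, by simpa using hu, fun n => ?_,
        ?_, ?_⟩
      · obtain ⟨k, hk | hk⟩ := shift_subst false (substs d x) n
        · rw [substs_cons, hk]
          refine ⟨?_, (subst_le_iff _).2 (hb k).2⟩
          rw [shift_eq_cons]
          cases (substs d x) k with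
          | false => rw [subst_cons_self, cons_le_cons, subst_le_iff]; exact (hb _).1
          | true => exact (lt_of_head rfl (by simp)).le
        · rw [substs_cons, hk]
          exact ⟨by rw [cons_le_cons, subst_le_iff]; exact (hb _).1,
            (lt_of_head rfl (by simpa using hu)).le⟩
      · rw [substs_cons, ← e0, subst_cons_self]
      · rw [substs_cons, ← e1, subst_false_cons_true]
    | true =>
      refine ⟨subst true l, cons true (subst true u), by simpa using hl, rfl, fun n => ?_,
        ?_, ?_⟩
      · obtain ⟨k, hk | hk⟩ := shift_subst true (substs d x) n
        · rw [substs_cons, hk]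
          refine ⟨(subst_le_iff _).2 (hb k).1, ?_⟩
          rw [shift_eq_cons]
          cases (substs d x) k with
          | true => rw [subst_cons_self, cons_le_cons, subst_le_iff]; exact (hb _).2
          | false => exact (lt_of_head (by simp) rfl).le
        · rw [substs_cons, hk]
          exact ⟨(lt_of_head (by simpa using hl) rfl).le,
            by rw [cons_le_cons, subst_le_iff]; exact (hb _).2⟩
      · rw [substs_cons, ← e0, subst_true_cons_false]
      · rw [substs_cons, ← e1, subst_cons_self]

/-- The suffixes of `substs d x` are controlled by the suffixes of `x`. -/
lemma substs_suffix_bounds (d : List Bool) {x lo hi : ℕ → Bool} (hlo : lo 0 = false)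
    (hhi : hi 0 = true)
    (h : ∀ n, toLex lo ≤ toLex (shift n x) ∧ toLex (shift n x) ≤ toLex hi) (n : ℕ) :
    (substs d x n = false →
      toLex (shift n (substs d x)) ≤ toLex (substs d (cons false hi))) ∧
    (substs d x n = true →
      toLex (substs d (cons true lo)) ≤ toLex (shift n (substs d x))) := by
  obtain ⟨l, u, -, -, hb, e0, e1⟩ := exists_bounds_substs d hlo hhi h
  rw [← e0, ← e1, shift_eq_cons]
  constructor
  · intro hn; rw [hn, cons_le_cons]; exact (hb _).2
  · intro hn; rw [hn, cons_le_cons]; exact (hb _).1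

/-! ### Desubstitution of words that obey the bounds of a node -/

lemma exists_switch {x : ℕ → Bool} {b : Bool} {k n : ℕ} (hk : x k = b) (hkn : k ≤ n)
    (hn : x n = !b) : ∃ m, k ≤ m ∧ m < n ∧ x m = b ∧ ∀ j, m < j → j ≤ n → x j = !b := by
  induction n with
  | zero =>
    obtain rfl : k = 0 := by omega
    rw [hk] at hn; simp at hn
  | succ n ih =>
    by_cases h : x n = b
    · rcases Nat.lt_or_ge k (n + 1) with h' | h'
      · refine ⟨n, by omega, by omega, h, fun j h1 h2 => ?_⟩
        obtain rfl : j = n + 1 := by omega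
        exact hn
      · obtain rfl : k = n + 1 := by omega
        rw [hk] at hn; simp at hn
    · have hkn' : k ≤ n := by
        by_contra h'
        obtain rfl : k = n + 1 := by omega
        rw [hk] at hn; simp at hn
      have hx : x n = !b := by cases b <;> simp_all
      obtain ⟨m, h1, h2, h3, h4⟩ := ih hkn' hx
      refine ⟨m, h1, by omega, h3, fun j h5 h6 => ?_⟩
      rcases Nat.lt_or_ge j (n + 1) with h' | h'
      · exact h4 j h5 (by omega)
      · obtain rfl : j = n + 1 := by omega
        exact hn

/-- Ones are isolated in an image of `subst false`, so such an image beginning with 0 is smaller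
than any word beginning with 011. -/
lemma not_isolated_false {x p : ℕ → Bool} {n : ℕ} (hp : p 0 = false) (h0 : x n = false)
    (h1 : x (n + 1) = true) (h2 : x (n + 2) = true)
    (h : toLex (shift n x) < toLex (subst false p)) : False := by
  obtain ⟨b, q, rfl⟩ := exists_cons p
  simp only [cons_zero] at hp
  subst hp
  rw [subst_cons_self, shift_eq_cons, h0, cons_lt_cons] at h
  have e1 : subst false q 0 = true := head_true_of_le h.le (by simpa using h1)
  have e2 := subst_isolated false q 0 (by simpa using e1)
  rw [shift_eq_cons, h1] at h
  obtain ⟨b, r, hr⟩ := exists_cons (subst false q)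
  rw [hr] at h e1 e2
  simp only [cons_zero] at e1
  subst e1
  rw [cons_lt_cons] at h
  have := head_true_of_le h.le (by simpa using h2)
  simp_all

lemma not_isolated_true {x p : ℕ → Bool} {n : ℕ} (hp : p 0 = true) (h0 : x n = true)
    (h1 : x (n + 1) = false) (h2 : x (n + 2) = false)
    (h : toLex (subst true p) < toLex (shift n x)) : False := by
  obtain ⟨b, q, rfl⟩ := exists_cons p
  simp only [cons_zero] at hp
  subst hp
  rw [subst_cons_self, shift_eq_cons, h0, cons_lt_cons] at h
  have e1 : subst true q 0 = false := head_false_of_le h.le (by simpa using h1)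
  have e2 := subst_isolated true q 0 (by simpa using e1)
  rw [shift_eq_cons, h1] at h
  obtain ⟨b, r, hr⟩ := exists_cons (subst true q)
  rw [hr] at h e1 e2
  simp only [cons_zero] at e1
  subst e1
  rw [cons_lt_cons] at h
  have := head_false_of_le h.le (by simpa using h2)
  simp_all

lemma subst_rep (c : Bool) : subst c (rep c) = rep c := by
  have h := subst_desubst c (rep c) (by intro n h; simp [rep] at h)
  rwa [show desubst c (rep c) = rep c from ?_] at h
  funext n
  induction n with
  | zero => rfl
  | succ n ih => simpa [desubst, rep] using ih

lemma subst_rep_not (c : Bool) : subst c (rep (!c)) = alt (!c) := by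
  have h := subst_desubst c (alt (!c)) (fun n hn => by simp [alt, hn])
  rwa [show desubst c (alt (!c)) = rep (!c) from ?_] at h
  funext n
  induction n with
  | zero => rfl
  | succ n ih => simpa [desubst, rep, alt, shift_two_alt] using ih

/-- The bounds forbid c(!c)(!c), so beyond the first c the word is parsed by blocks c and (!c)c.
Strictness of the bounds keeps the preimage from being eventually constant, which lets the step be
iterated. -/
lemma exists_subst_eq (c : Bool) {x p q : ℕ → Bool} (hx : NotEventuallyConst x)
    (hp : p 0 = false) (hq : q 0 = true)
    (hp' : toLex p ≤ toLex (cons false (rep true))) (hq' : toLex (cons true (rep false)) ≤ toLex q)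
    (h0 : ∀ n, x n = false → toLex (shift n x) < toLex (subst c p))
    (h1 : ∀ n, x n = true → toLex (subst c q) < toLex (shift n x)) :
    ∃ z m, NotEventuallyConst z ∧ shift m x = subst c z := by
  -- Starting at an occurrence of c ensures that each later run of !c is preceded by a c.
  obtain ⟨m, -, hm⟩ := hx c 0
  have iso : ∀ n, m ≤ n → x n = (!c) → x (n + 1) = c := by
    intro n hn hxn
    by_contra hxn1
    obtain ⟨k, -, hk, hk0, hk1⟩ := exists_switch hm hn hxn
    have hn1 : x (n + 1) = !c := by cases c <;> simp_all
    have a1 : x (k + 1) = !c := hk1 (k + 1) (by omega) (by omega)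
    have a2 : x (k + 2) = !c := by
      rcases Nat.lt_or_ge (k + 1) n with h | h
      · exact hk1 (k + 2) (by omega) (by omega)
      · obtain rfl : n = k + 1 := by omega
        exact hn1
    cases c with
    | false => exact not_isolated_false hp hk0 a1 a2 (h0 k hk0)
    | true => exact not_isolated_true hq hk0 a1 a2 (h1 k hk0)
  have key : subst c (desubst c (shift m x)) = shift m x := by
    apply subst_desubst
    intro n hn
    have := iso (n + m) (by omega) hn
    rw [shift_apply, show n + 1 + m = n + m + 1 by omega]
    exact this
  set z := desubst c (shift m x) with hz
  have hz0 : z 0 = c := by rw [hz]; simpa [desubst] using hm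
  refine ⟨z, m, fun b n => ?_, key.symm⟩
  by_contra hcon
  push Not at hcon
  have hconst : ∀ k, n ≤ k → shift k z = rep (!b) := by
    intro k hk
    funext j
    have := hcon (j + k) (by omega)
    simp only [shift, rep]
    cases b <;> simp_all
  -- A preimage ending in c^∞ would make x eventually constant. One ending in c(!c)^∞ would give x a
  -- suffix violating the strict bound on its side.
  by_cases hb : b = !c
  · obtain ⟨k, -, e⟩ := subst_shift c z n
    rw [hconst n le_rfl, hb, Bool.not_not, subst_rep, key, shift_shift] at e
    obtain ⟨j, hj, hxj⟩ := hx (!c) (k + m)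
    have := congrFun e (j - (k + m))
    rw [shift_apply, Nat.sub_add_cancel hj, hxj] at this
    simp [rep] at this
  · have hb : b = c := by cases b <;> cases c <;> simp_all
    subst hb
    obtain ⟨k, -, -, hk0, hk1⟩ := exists_switch (n := n) hz0 (by omega)
      (by have := congrFun (hconst n le_rfl) 0; simpa [rep] using this)
    have e1 : shift (k + 1) z = rep (!b) := by
      funext j
      simp only [shift, rep]
      rcases Nat.lt_or_ge (j + (k + 1)) n with h | h
      · exact hk1 _ (by omega) (by omega)
      · have := congrFun (hconst _ h) 0
        simpa [rep] using this
    have e2 : shift k z = cons b (rep (!b)) := by rw [shift_eq_cons, hk0, e1]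
    obtain ⟨l, -, e⟩ := subst_shift b z k
    rw [key, shift_shift, e2] at e
    have hl : x (l + m) = b := by
      rw [← shift_apply_zero (l + m) x, e]; simp
    cases b with
    | false =>
      have := h0 _ hl
      rw [e, subst_lt_iff] at this
      exact absurd this (not_lt.2 hp')
    | true =>
      have := h1 _ hl
      rw [e, subst_lt_iff] at this
      exact absurd this (not_lt.2 hq')

/-- A word obeying the bounds of a node of the tree of substitutions is eventually an image
under the substitution of that node. -/
lemma exists_substs_eq (d : List Bool) {x : ℕ → Bool} (hx : NotEventuallyConst x)
    (h0 : ∀ n, x n = false → toLex (shift n x) < toLex (substs d (cons false (rep true))))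
    (h1 : ∀ n, x n = true → toLex (substs d (cons true (rep false))) < toLex (shift n x)) :
    ∃ z m, NotEventuallyConst z ∧ shift m x = substs d z := by
  induction d generalizing x with
  | nil => exact ⟨x, 0, hx, rfl⟩
  | cons c d ih =>
    have hp : substs d (cons false (rep true)) 0 = false := by simp
    have hq : substs d (cons true (rep false)) 0 = true := by simp
    have hp' : toLex (substs d (cons false (rep true))) ≤ toLex (cons false (rep true)) := by
      rw [← cons_eta (substs d _), hp, cons_le_cons]; exact le_rep_true _
    have hq' : toLex (cons true (rep false)) ≤ toLex (substs d (cons true (rep false))) := by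
      rw [← cons_eta (substs d _), hq, cons_le_cons]; exact rep_false_le _
    obtain ⟨y, m, hy, e⟩ := exists_subst_eq c hx hp hq hp' hq' h0 h1
    have aux : ∀ n, ∃ k, shift k x = subst c (shift n y) ∧ x k = y n := by
      intro n
      obtain ⟨k, -, hk⟩ := subst_shift c y n
      rw [← e, shift_shift] at hk
      exact ⟨_, hk, by rw [← shift_apply_zero (k + m) x, hk]; simp⟩
    obtain ⟨z, l, hz, e'⟩ := ih hy
      (fun n hn => by
        obtain ⟨k, hk, hk'⟩ := aux n
        have := h0 k (hk'.trans hn)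
        rwa [hk, substs_cons, subst_lt_iff] at this)
      (fun n hn => by
        obtain ⟨k, hk, hk'⟩ := aux n
        have := h1 k (hk'.trans hn)
        rwa [hk, substs_cons, subst_lt_iff] at this)
    obtain ⟨k, hk, -⟩ := aux l
    exact ⟨z, k, hz, by rw [hk, e', substs_cons]⟩

/-! ### Binary expansions -/

lemma summable_value (x : ℕ → Bool) :
    Summable fun n : ℕ => (if x n then (1 : ℝ) else 0) / 2 ^ (n + 1) := by
  refine Summable.of_nonneg_of_le (fun n => by positivity) (fun n => ?_)
    (summable_geometric_of_lt_one (r := (1 / 2 : ℝ)) (by norm_num) (by norm_num))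
  rw [one_div, inv_pow, ← one_div]
  refine div_le_div₀ (by norm_num) (by split_ifs <;> norm_num) (by positivity) ?_
  exact pow_le_pow_right₀ (by norm_num) (by omega)

lemma value_cons (b : Bool) (x : ℕ → Bool) :
    value (cons b x) = (if b then 1 else 0) / 2 + value x / 2 := by
  unfold value
  rw [(summable_value (cons b x)).tsum_eq_zero_add, ← tsum_div_const]
  congr 1
  · cases b <;> simp
  · refine tsum_congr fun n => ?_
    rw [cons_succ, pow_succ _ (n + 1), div_div]

lemma value_cons_false (x : ℕ → Bool) : value (cons false x) = value x / 2 := by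
  simp [value_cons]
lemma value_cons_true (x : ℕ → Bool) : value (cons true x) = 1 / 2 + value x / 2 := by
  simp [value_cons]

lemma value_nonneg (x : ℕ → Bool) : 0 ≤ value x := tsum_nonneg fun n => by positivity

lemma value_rep_false : value (rep false) = 0 := by simp [value, rep]

lemma value_rep_true : value (rep true) = 1 := by
  have := value_cons_true (rep true)
  rw [← rep_eq_cons] at this
  linarith

lemma value_le_one (x : ℕ → Bool) : value x ≤ 1 := by
  rw [← value_rep_true]
  refine (summable_value x).tsum_le_tsum (fun n => ?_) (summable_value _)
  gcongr
  simp only [rep]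
  split_ifs <;> simp

lemma value_mem_Icc (x : ℕ → Bool) : value x ∈ Icc (0 : ℝ) 1 := ⟨value_nonneg x, value_le_one x⟩

lemma value_lt_one {x : ℕ → Bool} {n : ℕ} (h : x n = false) : value x < 1 := by
  induction n generalizing x with
  | zero =>
    obtain ⟨b, x, rfl⟩ := exists_cons x
    simp only [cons_zero] at h
    rw [h, value_cons_false]
    linarith [value_le_one x]
  | succ n ih =>
    obtain ⟨b, x, rfl⟩ := exists_cons x
    have := ih (x := x) h
    rw [value_cons]
    split_ifs <;> linarith

lemma value_pos {x : ℕ → Bool} {n : ℕ} (h : x n = true) : 0 < value x := by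
  induction n generalizing x with
  | zero =>
    obtain ⟨b, x, rfl⟩ := exists_cons x
    simp only [cons_zero] at h
    rw [h, value_cons_true]
    linarith [value_nonneg x]
  | succ n ih =>
    obtain ⟨b, x, rfl⟩ := exists_cons x
    have := ih (x := x) h
    rw [value_cons]
    split_ifs <;> linarith

lemma value_le_half {x : ℕ → Bool} (h : x 0 = false) : value x ≤ 1 / 2 := by
  rw [← cons_eta x, h, value_cons_false]; linarith [value_le_one (shift 1 x)]

lemma half_le_value {x : ℕ → Bool} (h : x 0 = true) : 1 / 2 ≤ value x := by
  rw [← cons_eta x, h, value_cons_true]; linarith [value_nonneg (shift 1 x)]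

lemma value_mono {x y : ℕ → Bool} (h : toLex x ≤ toLex y) : value x ≤ value y := by
  rcases h.eq_or_lt with h' | h'
  · rw [toLex.injective h']
  obtain ⟨i, h1, h2⟩ := seq_lt_iff.1 h'
  clear h h'
  induction i generalizing x y with
  | zero =>
    simp only [Bool.lt_iff] at h2
    exact (value_le_half h2.1).trans (half_le_value h2.2)
  | succ i ih =>
    obtain ⟨b, x, rfl⟩ := exists_cons x
    obtain ⟨b', y, rfl⟩ := exists_cons y
    obtain rfl : b = b' := h1 0 (by omega)
    have := ih (x := x) (y := y) (fun j hj => h1 (j + 1) (by omega)) h2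
    rw [value_cons, value_cons]
    linarith

lemma lt_of_value_lt {x y : ℕ → Bool} (h : value x < value y) : toLex x < toLex y := by
  by_contra h'
  exact absurd (value_mono (not_lt.1 h')) (not_le.2 h)

/-- Distinct words share a value only as the two expansions w01^∞ and w10^∞ of a dyadic number, and
the smaller of these is eventually constant. -/
lemma value_strictMono {x y : ℕ → Bool} (hx : NotEventuallyConst x) (h : toLex x < toLex y) :
    value x < value y := by
  obtain ⟨i, h1, h2⟩ := seq_lt_iff.1 h
  clear h
  induction i generalizing x y with
  | zero =>
    simp only [Bool.lt_iff] at h2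
    refine lt_of_lt_of_le ?_ (half_le_value h2.2)
    obtain ⟨m, hm, e⟩ := hx false 1
    rw [← cons_eta x, h2.1, value_cons_false]
    have := value_lt_one (x := shift 1 x) (n := m - 1)
      (by rw [shift_apply, Nat.sub_add_cancel hm]; exact e)
    linarith
  | succ i ih =>
    have hs := notEventuallyConst_shift 1 hx
    obtain ⟨b, x, rfl⟩ := exists_cons x
    obtain ⟨b', y, rfl⟩ := exists_cons y
    obtain rfl : b = b' := h1 0 (by omega)
    have := ih (x := x) (y := y) hs (fun j hj => h1 (j + 1) (by omega)) h2
    rw [value_cons, value_cons]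
    linarith

lemma value_injOn {x y : ℕ → Bool} (hx : NotEventuallyConst x) (hy : NotEventuallyConst y)
    (h : value x = value y) : x = y := by
  rcases lt_trichotomy (toLex x) (toLex y) with h' | h' | h'
  · exact absurd h (value_strictMono hx h').ne
  · exact toLex.injective h'
  · exact absurd h (value_strictMono hy h').ne'

@[simp] lemma concat_nil (x : ℕ → Bool) : concat [] x = x := by funext n; simp [concat]

@[simp] lemma concat_cons (b : Bool) (w : List Bool) (x : ℕ → Bool) :
    concat (b :: w) x = cons b (concat w x) := by
  funext n
  cases n <;> simp [concat]

lemma concat_append (u v : List Bool) (x : ℕ → Bool) :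
    concat (u ++ v) x = concat u (concat v x) := by
  induction u with
  | nil => simp
  | cons b u ih => simp [ih]

lemma abs_value_concat_sub_le (w : List Bool) (x y : ℕ → Bool) :
    |value (concat w x) - value (concat w y)| ≤ 1 / 2 ^ w.length := by
  induction w with
  | nil =>
    simp only [concat_nil, List.length_nil, pow_zero, div_one]
    rw [abs_le]
    constructor <;> linarith [value_nonneg x, value_nonneg y, value_le_one x, value_le_one y]
  | cons b w ih =>
    rw [concat_cons, concat_cons, value_cons, value_cons, List.length_cons, pow_succ, ← div_div,
      add_sub_add_left_eq_sub, ← sub_div, abs_div, abs_two]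
    linarith

/-! ### Itineraries under the doubling map -/

lemma T_mem_Icc {x : ℝ} (hx : x ∈ Icc (0 : ℝ) 1) : T x ∈ Icc (0 : ℝ) 1 := by
  obtain ⟨h0, h1⟩ := hx
  unfold T
  split_ifs with h
  · exact ⟨by linarith, by linarith⟩
  · push Not at h
    exact ⟨by linarith, by linarith⟩

lemma iterate_T_mem_Icc {x : ℝ} (hx : x ∈ Icc (0 : ℝ) 1) (n : ℕ) :
    T^[n] x ∈ Icc (0 : ℝ) 1 := by
  induction n generalizing x with
  | zero => exact hx
  | succ n ih => exact ih (T_mem_Icc hx)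

/-- The binary expansion of `x` read off its orbit. -/
noncomputable def itinerary (x : ℝ) : ℕ → Bool := fun n => decide (1 / 2 < T^[n] x)

lemma shift_itinerary (n : ℕ) (x : ℝ) : shift n (itinerary x) = itinerary (T^[n] x) := by
  funext k
  simp only [shift, itinerary, Function.iterate_add_apply]

/-- The error at x is half the error at T x; being bounded on [0,1], it must vanish. The strict
inequality in `itinerary` codes 1/2 as 0111…, in agreement with T(1/2) = 1. -/
lemma sub_value_itinerary (x : ℝ) :
    x - value (itinerary x) = (T x - value (itinerary (T x))) / 2 := by
  have h : itinerary x = cons (decide (1 / 2 < x)) (itinerary (T x)) := by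
    rw [← cons_eta (itinerary x), shift_itinerary]; rfl
  rw [h, value_cons]
  unfold T
  by_cases hx : x ≤ 1 / 2
  · simp only [if_pos hx, decide_eq_true_eq, if_neg (not_lt.2 hx)]; ring
  · simp only [if_neg hx, decide_eq_true_eq, if_pos (not_le.1 hx)]; ring

lemma value_itinerary {x : ℝ} (hx : x ∈ Icc (0 : ℝ) 1) : value (itinerary x) = x := by
  have key : ∀ n : ℕ, ∀ x ∈ Icc (0 : ℝ) 1, |x - value (itinerary x)| ≤ (1 / 2) ^ n := by
    intro n
    induction n with
    | zero =>
      intro x hx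
      rw [pow_zero, abs_le]
      have := value_nonneg (itinerary x)
      have := value_le_one (itinerary x)
      obtain ⟨h0, h1⟩ := hx
      constructor <;> linarith
    | succ n ih =>
      intro x hx
      rw [sub_value_itinerary, abs_div, abs_two, pow_succ]
      linarith [ih (T x) (T_mem_Icc hx)]
  have lim := tendsto_pow_atTop_nhds_zero_of_lt_one (r := (1 / 2 : ℝ)) (by norm_num) (by norm_num)
  have := ge_of_tendsto' lim fun n => key n x hx
  have := abs_nonpos_iff.1 this
  linarith

lemma iterate_T_eq_value {x : ℝ} (hx : x ∈ Icc (0 : ℝ) 1) (n : ℕ) :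
    T^[n] x = value (shift n (itinerary x)) := by
  rw [shift_itinerary, value_itinerary (iterate_T_mem_Icc hx n)]

/-- The only word to exclude is 10^∞, whose value 1/2 is sent to 1 and not to 0. -/
lemma T_value {x : ℕ → Bool} (hx : NotEventuallyConst x) : T (value x) = value (shift 1 x) := by
  have e := cons_eta x
  cases h : x 0 with
  | false =>
    rw [h] at e
    rw [T, if_pos (value_le_half h), ← e, value_cons_false]
    simp; ring
  | true =>
    rw [h] at e
    obtain ⟨m, hm, hm'⟩ := hx true 1
    have hp : 0 < value (shift 1 x) := value_pos (n := m - 1)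
      (by rw [shift_apply, Nat.sub_add_cancel hm]; exact hm')
    have hv : value x = 1 / 2 + value (shift 1 x) / 2 := by
      conv_lhs => rw [← e]
      rw [value_cons_true]
    rw [T, if_neg (by linarith), hv]
    ring

lemma iterate_T_value {x : ℕ → Bool} (hx : NotEventuallyConst x) (n : ℕ) :
    T^[n] (value x) = value (shift n x) := by
  induction n generalizing x with
  | zero => rfl
  | succ n ih =>
    rw [Function.iterate_succ_apply, T_value hx, ih (notEventuallyConst_shift 1 hx), shift_shift]

lemma countable_T_preimage {C : Set ℝ} (hC : C.Countable) (n : ℕ) :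
    (T^[n] ⁻¹' C).Countable := by
  induction n with
  | zero => exact hC
  | succ n ih =>
    have : T^[n + 1] ⁻¹' C ⊆ (fun y => y / 2) '' (T^[n] ⁻¹' C) ∪
        (fun y => (y + 1) / 2) '' (T^[n] ⁻¹' C) := by
      intro x hx
      simp only [mem_preimage, Function.iterate_succ_apply] at hx
      by_cases h : x ≤ 1 / 2
      · exact Or.inl ⟨T x, hx, by rw [T, if_pos h]; ring⟩
      · exact Or.inr ⟨T x, hx, by rw [T, if_neg h]; ring⟩
    exact ((ih.image _).union (ih.image _)).mono this

/-! ### Avoiding a hole -/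

lemma mem_J_value {a b : ℝ} {x α β : ℕ → Bool} (hx : NotEventuallyConst x)
    (hα : value α ≤ a) (hβ : b ≤ value β)
    (h : ∀ n, (x n = false → toLex (shift n x) ≤ toLex α) ∧
      (x n = true → toLex β ≤ toLex (shift n x))) : value x ∈ J a b := by
  refine ⟨value_mem_Icc x, fun n hn => ?_⟩
  rw [iterate_T_value hx] at hn
  cases hxn : x n with
  | false => exact absurd ((value_mono ((h n).1 hxn)).trans hα) (not_le.2 hn.1)
  | true => exact absurd (hβ.trans (value_mono ((h n).2 hxn))) (not_le.2 hn.2)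

/-- The hole extends past 1/2, so an orbit point in the left half can only avoid it by staying at or
below a. -/
lemma value_le_of_mem_J {a b x : ℝ} (hx : x ∈ J a b) (hb : 1 / 2 < b) {n : ℕ}
    (h : itinerary x n = false) : value (shift n (itinerary x)) ≤ a := by
  by_contra hcon
  have := hx.2 n
  rw [iterate_T_eq_value hx.1] at this
  exact this ⟨not_le.1 hcon, (value_le_half (by simpa using h)).trans_lt hb⟩

lemma le_value_of_mem_J {a b x : ℝ} (hx : x ∈ J a b) (ha : a < 1 / 2) {n : ℕ}
    (h : itinerary x n = true) : b ≤ value (shift n (itinerary x)) := by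
  by_contra hcon
  have := hx.2 n
  rw [iterate_T_eq_value hx.1] at this
  exact this ⟨ha.trans_le (half_le_value (by simpa using h)), not_le.1 hcon⟩

lemma zero_one_subset_J {a b : ℝ} (ha : 0 < a) (hb : b < 1) : ({0, 1} : Set ℝ) ⊆ J a b := by
  have h0 : ∀ n, T^[n] 0 = 0 := fun n => Function.iterate_fixed (by simp [T]) n
  have h1 : ∀ n, T^[n] 1 = 1 := fun n => Function.iterate_fixed (by norm_num [T]) n
  rintro x (rfl | rfl)
  · exact ⟨by simp, fun n hn => by rw [h0] at hn; exact absurd hn.1 (not_lt.2 ha.le)⟩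
  · exact ⟨by simp, fun n hn => by rw [h1] at hn; exact absurd hn.2 (not_lt.2 hb.le)⟩

/-- An eventually constant itinerary reaches 0 or 1. Going backwards, the only way to enter these
fixed points from elsewhere is through 1/2, which lies in the hole. -/
lemma notEventuallyConst_itinerary {a b x : ℝ} (ha : a < 1 / 2) (hb : 1 / 2 < b)
    (hx : x ∈ J a b) (h0 : x ≠ 0) (h1 : x ≠ 1) : NotEventuallyConst (itinerary x) := by
  intro c n
  by_contra hcon
  push Not at hcon
  have hrep : shift n (itinerary x) = rep (!c) := by
    funext j
    have := hcon (j + n) (by omega)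
    simp only [shift, rep]
    cases c <;> simp_all
  have hT : T^[n] x = 0 ∨ T^[n] x = 1 := by
    rw [iterate_T_eq_value hx.1, hrep]
    cases c
    · exact Or.inr value_rep_true
    · exact Or.inl value_rep_false
  clear hrep hcon
  induction n with
  | zero => rcases hT with h | h
            · exact h0 h
            · exact h1 h
  | succ n ih =>
    apply ih
    rw [Function.iterate_succ_apply'] at hT
    have hm := iterate_T_mem_Icc hx.1 n
    have hne : T^[n] x ≠ 1 / 2 := fun h => hx.2 n (by rw [h]; exact ⟨ha, hb⟩)
    generalize T^[n] x = y at *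
    obtain ⟨l, u⟩ := hm
    unfold T at hT
    split_ifs at hT with h
    · have h := lt_of_le_of_ne h hne
      rcases hT with hT | hT
      · left; linarith
      · linarith
    · push Not at h
      rcases hT with hT | hT
      · linarith
      · right; linarith

/-! ### Bounds for `phi` and `chi` in terms of the nodes -/

lemma bddAbove_phi (a : ℝ) : BddAbove {b : ℝ | a < b ∧ b < 1 ∧ J a b ≠ {0, 1}} :=
  ⟨1, fun _ hb => hb.2.1.le⟩

lemma chi_le_phi {a : ℝ} (ha : 0 < a) : chi a ≤ phi a := by
  -- The supremum of an empty set is 0, so the upper bound must also be shown nonnegative.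
  apply Real.sSup_le
  · rintro b ⟨h1, h2, h3⟩
    refine le_csSup (bddAbove_phi a) ⟨h1, h2, fun h => h3 ?_⟩
    rw [h]; exact (Set.toFinite _).countable
  · exact Real.sSup_nonneg fun b hb => ha.le.trans hb.1.le

lemma half_lt_value_substs (d : List Bool) {x : ℕ → Bool} {n : ℕ} (hx : x n = true) :
    1 / 2 < value (substs d (cons true x)) := by
  have h0 : substs d (cons true x) 0 = true := by simp
  rw [← cons_eta (substs d _), h0, value_cons_true]
  obtain ⟨m, hm, e⟩ := substs_shift d (cons true x) (n + 1)
  have : 0 < value (shift 1 (substs d (cons true x))) := by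
    apply value_pos (n := m - 1)
    rw [shift_apply, Nat.sub_add_cancel (by omega), ← shift_apply_zero m (substs _ _), e]
    simpa using hx
  linarith

/-- The witness is the orbit of σ((01)^∞): with all suffixes of (01)^∞ lying between (01)^∞ and
(10)^∞, the suffix bounds read 0(10)^∞ = (01)^∞ and 1(01)^∞ = (10)^∞. -/
lemma periodic_le_phi (d : List Bool) {a : ℝ} (ha : a < 1 / 2)
    (h : value (substs d (alt false)) ≤ a) : value (substs d (alt true)) ≤ phi a := by
  have hnec := notEventuallyConst_substs d (notEventuallyConst_alt false)
  have hmem : value (substs d (alt false)) ∈ J a (value (substs d (alt true))) := by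
    refine mem_J_value hnec h le_rfl fun n => ?_
    have := substs_suffix_bounds d (x := alt false) (lo := alt false) (hi := alt true) rfl rfl
      (fun n => ?_) n
    · rwa [← Bool.not_false, ← alt_eq_cons, Bool.not_false, ← Bool.not_true, ← alt_eq_cons,
        Bool.not_true] at this
    · have hs : shift n (alt false) = alt false ∨ shift n (alt false) = alt true := by
        induction n with
        | zero => exact Or.inl rfl
        | succ n ih =>
          rw [add_comm, ← shift_shift]
          rcases ih with ih | ih
          · right; rw [ih, alt_eq_cons]; rfl
          · left; rw [ih, alt_eq_cons]; rfl
      have hle : toLex (alt false) ≤ toLex (alt true) := (lt_of_head rfl rfl).le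
      rcases hs with hs | hs <;> rw [hs]
      · exact ⟨le_rfl, hle⟩
      · exact ⟨hle, le_rfl⟩
  refine le_csSup (bddAbove_phi a) ⟨?_, ?_, fun hJ => ?_⟩
  · exact ha.trans_le (half_le_value (by simp [alt]))
  · obtain ⟨m, -, hm⟩ := notEventuallyConst_substs d (notEventuallyConst_alt true) false 0
    exact value_lt_one hm
  · rw [hJ] at hmem
    obtain ⟨m, -, hm⟩ := hnec false 0
    obtain ⟨k, -, hk⟩ := hnec true 0
    rcases hmem with e | e
    · exact (value_pos hk).ne' e
    · exact (value_lt_one hm).ne e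

lemma notEventuallyConst_subst_true_subst_false (s : ℕ → Bool) :
    NotEventuallyConst (subst true (subst false s)) := by
  have h1 : ∀ n, ∃ m, n ≤ m ∧ subst true (subst false s) m = true := by
    intro n
    by_cases h : subst true (subst false s) n = true
    · exact ⟨n, le_rfl, h⟩
    · exact ⟨n + 1, by omega, subst_isolated true _ n (by simpa using h)⟩
  have h0 : ∀ n, ∃ m, n ≤ m ∧ subst true (subst false s) m = false := by
    intro n
    obtain ⟨k, hk, e⟩ : ∃ k, n ≤ k ∧ subst false s k = false := by
      by_cases h : subst false s n = false
      · exact ⟨n, le_rfl, h⟩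
      · exact ⟨n + 1, by omega, subst_isolated false _ n (by simpa using h)⟩
    obtain ⟨m, hm, e'⟩ := subst_shift true (subst false s) k
    refine ⟨m, by omega, ?_⟩
    rw [← shift_apply_zero m (subst _ _), e']; simpa using e
  intro b
  cases b
  · exact h0
  · exact h1

/-- Every word σ(x) satisfies the bounds. Applying `subst false` and then `subst true` first makes
both letters recur, so distinct parameters s yield distinct real numbers. -/
lemma uncountable_J (d : List Bool) {a b : ℝ} (ha : value (substs d (cons false (rep true))) ≤ a)
    (hb : b ≤ value (substs d (cons true (rep false)))) : ¬ (J a b).Countable := by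
  intro hc
  let f : (ℕ → Bool) → ℝ := fun s => value (substs d (subst true (subst false s)))
  have hnec : ∀ s, NotEventuallyConst (substs d (subst true (subst false s))) := fun s =>
    notEventuallyConst_substs d (notEventuallyConst_subst_true_subst_false s)
  have hf : Function.Injective f := by
    intro s t h
    have := value_injOn (hnec s) (hnec t) h
    exact substs_injective (d ++ [true, false]) (by simpa [substs_append] using this)
  have hr : range f ⊆ J a b := by
    rintro _ ⟨s, rfl⟩
    exact mem_J_value (hnec s) ha hb fun n => substs_suffix_bounds d rfl rfl
      (fun n => ⟨rep_false_le _, le_rep_true _⟩) n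
  have h1 : (range f).Countable := hc.mono hr
  have h2 : (univ : Set (ℕ → Bool)).Countable := by
    rw [← preimage_range f]; exact h1.preimage hf
  have h3 : Countable (ℕ → Bool) := countable_univ_iff.1 h2
  have h4 := Cardinal.mk_le_aleph0_iff.2 h3
  rw [← Cardinal.power_def, Cardinal.mk_bool, Cardinal.mk_nat] at h4
  exact absurd (Cardinal.cantor Cardinal.aleph0) (not_lt.2 h4)

lemma le_chi (d : List Bool) {a : ℝ} (ha : a < 1 / 2)
    (h : value (substs d (cons false (rep true))) ≤ a) :
    value (substs d (cons true (rep false))) ≤ chi a := by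
  refine le_csSup ⟨1, fun _ hb => hb.2.1.le⟩ ⟨?_, ?_, uncountable_J d h le_rfl⟩
  · exact ha.trans_le (half_le_value (by simp))
  · obtain ⟨m, -, e⟩ := substs_shift d (cons true (rep false)) 1
    apply value_lt_one (n := m)
    rw [← shift_apply_zero m (substs _ _), e]; simp [rep]

/-- With a larger right end, a nontrivial itinerary would eventually be σ(z) with every suffix of z
that begins with 1 exceeding 101^∞. But z contains 10, and a suffix beginning with 10 is at most
101^∞. -/
lemma phi_le (d : List Bool) {a : ℝ} (ha0 : 0 < a) (ha : a < 1 / 2)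
    (h : a < value (substs d (cons false (rep true)))) :
    phi a ≤ value (substs d (cons true (cons false (rep true)))) := by
  apply Real.sSup_le _ (value_nonneg _)
  rintro b ⟨-, hb1, hJ⟩
  by_contra hb
  push Not at hb
  have hb2 : 1 / 2 < b :=
    (half_lt_value_substs d (x := cons false (rep true)) (n := 1) rfl).trans hb
  apply hJ
  refine subset_antisymm (fun x hx => ?_) (zero_one_subset_J ha0 hb1)
  by_contra hx01
  simp only [mem_insert_iff, mem_singleton_iff, not_or] at hx01
  have hnec := notEventuallyConst_itinerary ha hb2 hx hx01.1 hx01.2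
  have up : ∀ n, itinerary x n = true →
      toLex (substs d (cons true (cons false (rep true)))) < toLex (shift n (itinerary x)) :=
    fun n hn => lt_of_value_lt (hb.trans_le (le_value_of_mem_J hx ha hn))
  obtain ⟨z, m, hz, e⟩ := exists_substs_eq d hnec
    (fun n hn => lt_of_value_lt ((value_le_of_mem_J hx hb2 hn).trans_lt h))
    (fun n hn => lt_of_le_of_lt (by
      rw [substs_le_iff, cons_le_cons]; exact rep_false_le _) (up n hn))
  obtain ⟨k, -, hk⟩ := hz true 0
  obtain ⟨l, hl, hl'⟩ := hz false k
  obtain ⟨i, -, hil, hi, hi'⟩ := exists_switch hk hl hl'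
  obtain ⟨j, -, ej⟩ := substs_shift d z i
  have hh := up (j + m) (by
    rw [← shift_apply_zero (j + m) (itinerary x), ← shift_shift, e, ej]; simpa using hi)
  rw [← shift_shift, e, ej, substs_lt_iff, shift_eq_cons, hi, cons_lt_cons, shift_eq_cons,
    hi' (i + 1) (by omega) (by omega)] at hh
  exact absurd (cons_lt_cons.1 hh) (not_lt.2 (le_rep_true _))

/-! ### Rigidity of alternating words and the upper bound for `chi` -/

lemma eq_alt_of_no_repeat {z : ℕ → Bool} (h : ∀ n, z (n + 1) = !(z n)) : z = alt (z 0) := by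
  funext n
  induction n with
  | zero => rfl
  | succ n ih => rw [h, ih]; rfl

/-- The word (10)^∞ is the smallest one that begins with 1 and has no factor 00. -/
lemma eq_alt_of_le {y : ℕ → Bool} (h0 : y 0 = true) (hy : ∀ n, y n = false → y (n + 1) = true)
    (h : toLex y ≤ toLex (alt true)) : y = alt true := by
  funext n
  suffices H : ∀ n (y : ℕ → Bool), y 0 = true → (∀ n, y n = false → y (n + 1) = true) →
      toLex y ≤ toLex (alt true) → y n = alt true n from H n y h0 hy h
  clear h0 hy h y n
  intro n
  induction n using Nat.strong_induction_on with
  | _ n ih =>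
    intro y h0 hy h
    have e : alt true = cons true (cons false (alt true)) := alt_eq_cons_cons true
    have h' := h
    rw [← cons_eta y, h0, e, cons_le_cons, shift_eq_cons] at h'
    have h1 : y 1 = false := by simpa using head_false_of_le h' rfl
    match n, ih with
    | 0, _ => exact h0
    | 1, _ => rw [h1]; rfl
    | n + 2, ih =>
      rw [h1, cons_le_cons] at h'
      have := ih n (by omega) (shift 2 y) (by simpa using hy 1 h1)
        (fun n hn => by
          have := hy (n + 2) hn
          rwa [show n + 2 + 1 = n + 1 + 2 by omega] at this) h'
      rw [e]
      exact this

/-- Words between `01(10)^∞` and `1001(10)^∞` are eventually alternating. -/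
lemma eventually_alt {z : ℕ → Bool} (hz : NotEventuallyConst z)
    (h0 : ∀ n, z n = false → toLex (shift n z) ≤ toLex (cons false (cons true (alt true))))
    (h1 : ∀ n, z n = true →
      toLex (cons true (cons false (cons false (cons true (alt true))))) < toLex (shift n z)) :
    ∃ n b, shift n z = alt b := by
  -- A suffix 100… above 1001(10)^∞ would contain a suffix beginning with 0 above 01(10)^∞.
  have no100 : ∀ n, z n = true → z (n + 1) = false → z (n + 2) = true := by
    intro n a b
    by_contra c
    have h := h1 n a
    rw [shift_eq_cons, a, cons_lt_cons, shift_eq_cons, b, cons_lt_cons] at h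
    exact absurd (h0 (n + 2) (by simpa using c)) (not_le.2 h)
  obtain ⟨m, -, hm⟩ := hz true 0
  have no00 : ∀ n, m ≤ n → z n = false → z (n + 1) = true := by
    intro n hn hzn
    obtain ⟨k, -, hk, hk0, hk1⟩ := exists_switch hm hn hzn
    rcases Nat.lt_or_ge (k + 1) n with h | h
    · have := no100 k hk0 (hk1 _ (by omega) (by omega))
      rw [hk1 _ (by omega) (by omega)] at this
      simp at this
    · obtain rfl : n = k + 1 := by omega
      exact no100 k hk0 hzn
  -- After an occurrence of 011, the tail from its last 1 is at most (10)^∞ and has no 00, hence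
  -- equals (10)^∞. If 011 never recurs, the letters already alternate.
  by_cases hex : ∃ n, m ≤ n ∧ z n = false ∧ z (n + 1) = true ∧ z (n + 2) = true
  · obtain ⟨n, hn, a, b, c⟩ := hex
    refine ⟨n + 2, true, eq_alt_of_le (by simpa using c) (fun k hk => ?_) ?_⟩
    · have := no00 (k + (n + 2)) (by omega) hk
      rw [shift_apply, show k + 1 + (n + 2) = k + (n + 2) + 1 by omega]
      exact this
    · have h := h0 n a
      rwa [shift_eq_cons, a, cons_le_cons, shift_eq_cons, b, cons_le_cons] at h
  · push Not at hex
    obtain ⟨n, hn, a⟩ := hz false m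
    refine ⟨n, false, ?_⟩
    have key : ∀ k, n ≤ k → z (k + 1) = !(z k) := by
      intro k hk
      induction k, hk using Nat.le_induction with
      | base => rw [a, no00 n hn a]; rfl
      | succ k hk ih =>
        cases hzk : z (k + 1) with
        | false => rw [no00 (k + 1) (by omega) hzk]; rfl
        | true =>
          rw [hzk] at ih
          have h0 : z k = false := by rw [← Bool.not_eq_true', ← ih]
          simpa using hex k (by omega) h0 hzk
    have := eq_alt_of_no_repeat (z := shift n z) (fun k => by
      have := key (k + n) (by omega)
      rw [shift_apply, show k + 1 + n = k + n + 1 by omega]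
      exact this)
    rwa [shift_apply_zero, a] at this

/-- Beyond this bound every avoiding orbit is a fixed point or eventually hits one of two points,
and iterated preimages under T of a finite set are countable. -/
lemma chi_le (d : List Bool) {a : ℝ} (ha : a < 1 / 2)
    (h : a ≤ value (substs d (cons false (cons true (alt true))))) :
    chi a ≤ value (substs d (cons true (cons false (cons false (cons true (alt true)))))) := by
  apply Real.sSup_le _ (value_nonneg _)
  rintro b ⟨-, hb1, hJ⟩
  by_contra hb
  push Not at hb
  have hb2 : 1 / 2 < b :=
    (half_lt_value_substs d (x := cons false (cons false (cons true (alt true)))) (n := 2)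
      rfl).trans hb
  apply hJ
  have hα : NotEventuallyConst (substs d (cons false (cons true (alt true)))) :=
    notEventuallyConst_substs d (notEventuallyConst_cons (notEventuallyConst_cons
      (notEventuallyConst_alt true)))
  let C : Set ℝ := {value (substs d (alt false)), value (substs d (alt true))}
  have hC : C.Countable := (Set.toFinite _).countable
  have hcount : (({0, 1} : Set ℝ) ∪ ⋃ n : ℕ, T^[n] ⁻¹' C).Countable :=
    (Set.toFinite _).countable.union (countable_iUnion fun n => countable_T_preimage hC n)
  refine hcount.mono fun x hx => ?_
  by_cases hx01 : x ∈ ({0, 1} : Set ℝ)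
  · exact Or.inl hx01
  right
  simp only [mem_insert_iff, mem_singleton_iff, not_or] at hx01
  have hnec := notEventuallyConst_itinerary ha hb2 hx hx01.1 hx01.2
  have up : ∀ n, itinerary x n = true →
      toLex (substs d (cons true (cons false (cons false (cons true (alt true)))))) <
        toLex (shift n (itinerary x)) :=
    fun n hn => lt_of_value_lt (hb.trans_le (le_value_of_mem_J hx ha hn))
  have down : ∀ n, itinerary x n = false →
      toLex (shift n (itinerary x)) ≤ toLex (substs d (cons false (cons true (alt true)))) := by
    intro n hn
    by_contra hcon
    exact absurd (value_strictMono hα (not_le.1 hcon))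
      (not_lt.2 ((value_le_of_mem_J hx hb2 hn).trans h))
  obtain ⟨z, m, hz, e⟩ := exists_substs_eq d hnec
    (fun n hn => lt_of_le_of_lt (down n hn) ((substs_lt_iff d).2 (cons_lt_cons.2
      (seq_lt_iff.2 ⟨2, fun j hj => by interval_cases j <;> rfl, by decide⟩))))
    (fun n hn => lt_of_le_of_lt (by
      rw [substs_le_iff, cons_le_cons]; exact rep_false_le _) (up n hn))
  have aux : ∀ n, ∃ k, shift k (itinerary x) = substs d (shift n z) ∧ itinerary x k = z n := by
    intro n
    obtain ⟨k, -, hk⟩ := substs_shift d z n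
    rw [← e, shift_shift] at hk
    exact ⟨_, hk, by rw [← shift_apply_zero (k + m) (itinerary x), hk]; simp⟩
  obtain ⟨n, c, hc⟩ := eventually_alt hz
    (fun n hn => by
      obtain ⟨k, hk, hk'⟩ := aux n
      have := down k (hk'.trans hn)
      rwa [hk, substs_le_iff] at this)
    (fun n hn => by
      obtain ⟨k, hk, hk'⟩ := aux n
      have := up k (hk'.trans hn)
      rwa [hk, substs_lt_iff] at this)
  obtain ⟨k, hk, -⟩ := aux n
  refine mem_iUnion.2 ⟨k, ?_⟩
  rw [mem_preimage, iterate_T_eq_value hx.1, hk, hc]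
  cases c
  · exact Or.inl rfl
  · exact Or.inr rfl

lemma chi_lt_phi (d : List Bool) {a : ℝ} (ha : a < 1 / 2)
    (h1 : value (substs d (alt false)) ≤ a)
    (h2 : a ≤ value (substs d (cons false (cons true (alt true))))) : chi a < phi a := by
  refine (chi_le d ha h2).trans_lt (lt_of_lt_of_le ?_ (periodic_le_phi d ha h1))
  apply value_strictMono
  · exact notEventuallyConst_substs d (notEventuallyConst_cons (notEventuallyConst_cons
      (notEventuallyConst_cons (notEventuallyConst_cons (notEventuallyConst_alt true)))))
  · rw [substs_lt_iff, alt_eq_cons true, cons_lt_cons, Bool.not_true, alt_eq_cons false,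
      cons_lt_cons]
    exact lt_of_head rfl rfl

/-! ### The substitutions on finite words -/

/-- The image of a finite word under the substitution `c ↦ c`, `!c ↦ (!c) c`. -/
def substWord (c : Bool) (w : List Bool) : List Bool :=
  w.flatMap fun b => if b = c then [c] else [b, c]

/-- The image of a finite word under the composition of substitutions coded by `d`. -/
def substsWord (d w : List Bool) : List Bool := d.foldr substWord w

@[simp] lemma substsWord_nil (w : List Bool) : substsWord [] w = w := rfl
@[simp] lemma substsWord_cons (c : Bool) (d w : List Bool) :
    substsWord (c :: d) w = substWord c (substsWord d w) := rfl

lemma substWord_append (c : Bool) (u v : List Bool) :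
    substWord c (u ++ v) = substWord c u ++ substWord c v := by simp [substWord]

lemma substsWord_append_word (d u v : List Bool) :
    substsWord d (u ++ v) = substsWord d u ++ substsWord d v := by
  induction d with
  | nil => rfl
  | cons c d ih => rw [substsWord_cons, ih, substWord_append]; rfl

lemma substsWord_append (d e w : List Bool) :
    substsWord (d ++ e) w = substsWord d (substsWord e w) := by simp [substsWord]

lemma substsWord_pair (d : List Bool) (b c : Bool) :
    substsWord d [b, c] = substsWord d [b] ++ substsWord d [c] :=
  substsWord_append_word d [b] [c]

lemma subst_concat (c : Bool) (w : List Bool) (x : ℕ → Bool) :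
    subst c (concat w x) = concat (substWord c w) (subst c x) := by
  induction w with
  | nil => simp [substWord]
  | cons b w ih =>
    have e : substWord c (b :: w) = substWord c [b] ++ substWord c w := substWord_append c [b] w
    rw [e, concat_cons, concat_append, ← ih]
    by_cases hb : b = c
    · rw [hb, subst_cons_self]; simp [substWord]
    · have hb : b = !c := by cases b <;> cases c <;> simp_all
      rw [hb, subst_cons_not]; simp [substWord]

lemma substs_concat (d w : List Bool) (x : ℕ → Bool) :
    substs d (concat w x) = concat (substsWord d w) (substs d x) := by
  induction d with
  | nil => rfl
  | cons c d ih => rw [substs_cons, ih, subst_concat]; rfl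

lemma length_le_length_substWord (c : Bool) (w : List Bool) :
    w.length ≤ (substWord c w).length := by
  induction w with
  | nil => simp
  | cons b w ih =>
    have e : substWord c (b :: w) = substWord c [b] ++ substWord c w := substWord_append c [b] w
    rw [e, List.length_append, List.length_cons]
    have : 1 ≤ (substWord c [b]).length := by simp only [substWord]; simp; split_ifs <;> simp
    omega

lemma length_le_length_substsWord (d w : List Bool) : w.length ≤ (substsWord d w).length := by
  induction d with
  | nil => rfl
  | cons c d ih => exact ih.trans (length_le_length_substWord c _)

lemma periodic_eq_of_concat {w : List Bool} {x : ℕ → Bool} (hw : w ≠ []) (h : concat w x = x) :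
    periodic w = x := by
  have hl : 0 < w.length := List.length_pos_iff.2 hw
  funext n
  induction n using Nat.strong_induction_on with
  | _ n ih =>
    rw [← h]
    by_cases hn : n < w.length
    · simp [periodic, concat, hn, Nat.mod_eq_of_lt hn]
    · rw [concat, if_neg hn, ← ih (n - w.length) (by omega), periodic, periodic,
        Nat.mod_eq_sub_mod (by omega)]

lemma periodic_substsWord (d : List Bool) (b : Bool) :
    periodic (substsWord d [b, !b]) = substs d (alt b) := by
  apply periodic_eq_of_concat
  · have := length_le_length_substsWord d [b, !b]
    intro h; rw [h] at this; simp at this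
  · rw [← substs_concat]
    congr 1
    rw [concat_cons, concat_cons, concat_nil]
    exact (alt_eq_cons_cons b).symm

/-! ### Counting letters in the words of a node -/

/-- Ones in the first `n` letters. -/
def ones (w : List Bool) (n : ℕ) : ℤ := (w.take n).count true

@[simp] lemma ones_zero (w : List Bool) : ones w 0 = 0 := by simp [ones]

lemma ones_of_length_le {w : List Bool} {n : ℕ} (h : w.length ≤ n) :
    ones w n = w.count true := by rw [ones, List.take_of_length_le h]

lemma ones_append_left {u v : List Bool} {n : ℕ} (h : n ≤ u.length) :
    ones (u ++ v) n = ones u n := by rw [ones, List.take_append_of_le_length h, ones]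

lemma ones_append_right (u v : List Bool) (n : ℕ) :
    ones (u ++ v) (u.length + n) = u.count true + ones v n := by
  rw [ones, List.take_length_add_append, List.count_append]; push_cast; rfl

/-- The prefix counts of `w` are the least integers above the line of slope `p / q` through
`(1, 0)`. -/
def IsUpper (w : List Bool) (p q : ℤ) : Prop :=
  ∀ n : ℕ, 1 ≤ n → n ≤ w.length → 0 ≤ q * ones w n - (n - 1) * p ∧
    q * ones w n - (n - 1) * p < q

/-- The prefix counts of `w` are the largest integers below the line of slope `p / q` through
`(1, 1)`. -/
def IsLower (w : List Bool) (p q : ℤ) : Prop :=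
  ∀ n : ℕ, 1 ≤ n → n ≤ w.length → -q < q * (ones w n - 1) - (n - 1) * p ∧
    q * (ones w n - 1) - (n - 1) * p ≤ 0

/-- The determinant condition makes a/i and b/j Farey neighbours with mediant (a+b)/(i+j). Passing
to the mediant slope moves the discrepancies so little that no integer is crossed. -/
lemma IsUpper.append {u v : List Bool} {a b i j : ℤ} (hi : (u.length : ℤ) = i)
    (hj : (v.length : ℤ) = j) (ha : (u.count true : ℤ) = a) (hj0 : 0 < j)
    (hdet : b * i - a * j = 1) (hu : IsUpper u a i) (hv : IsLower v b j) :
    IsUpper (u ++ v) (a + b) (i + j) := by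
  intro n hn hn'
  rw [List.length_append] at hn'
  rcases Nat.lt_or_ge u.length n with h | h
  · obtain ⟨m, rfl⟩ := Nat.exists_eq_add_of_le h.le
    have hm : m ≤ v.length := by omega
    obtain ⟨h1, h2⟩ := hv m (by omega) hm
    have hm1 : (1 : ℤ) ≤ m := by exact_mod_cast (by omega : 1 ≤ m)
    have hmj : (m : ℤ) ≤ j := by rw [← hj]; exact_mod_cast hm
    rw [ones_append_right, ha]
    push_cast
    rw [hi]
    set s := ones v m
    have key : j * ((i + j) * (a + s) - (i + m - 1) * (a + b)) =
        (i + j) * (j * (s - 1) - (m - 1) * b + j) - j + (m - 1) := by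
      linear_combination (-(j : ℤ) + (m - 1)) * hdet
    have hi0 : 0 ≤ i := by rw [← hi]; positivity
    constructor
    · nlinarith
    · nlinarith
  · obtain ⟨h1, h2⟩ := hu n hn h
    have hn1 : (1 : ℤ) ≤ n := by exact_mod_cast hn
    have hni : (n : ℤ) ≤ i := by rw [← hi]; exact_mod_cast h
    rw [ones_append_left h]
    set s := ones u n
    have key : i * ((i + j) * s - (n - 1) * (a + b)) =
        (i + j) * (i * s - (n - 1) * a) - (n - 1) := by
      linear_combination (-((n : ℤ) - 1)) * hdet
    have hi0 : 0 < i := by linarith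
    constructor
    · rcases h1.eq_or_lt with h0 | h0
      · have hd : i ∣ (n : ℤ) - 1 :=
          ⟨b * (n - 1) - s * j, by linear_combination (-((n : ℤ) - 1)) * hdet - j * h0⟩
        have : (n : ℤ) - 1 = 0 := Int.eq_zero_of_dvd_of_nonneg_of_lt (by linarith) (by linarith) hd
        have hs : i * s = 0 := by rw [this] at h0; linarith
        have hs : s = 0 := by rcases mul_eq_zero.1 hs with h | h; · omega
                              · exact h
        rw [this, hs]; simp
      · nlinarith
    · nlinarith

lemma IsLower.append {u v : List Bool} {a b i j : ℤ} (hi : (u.length : ℤ) = i)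
    (hj : (v.length : ℤ) = j) (hb : (v.count true : ℤ) = b) (hi0 : 0 < i)
    (hdet : b * i - a * j = 1) (hu : IsUpper u a i) (hv : IsLower v b j) :
    IsLower (v ++ u) (a + b) (i + j) := by
  intro n hn hn'
  rw [List.length_append] at hn'
  rcases Nat.lt_or_ge v.length n with h | h
  · obtain ⟨m, rfl⟩ := Nat.exists_eq_add_of_le h.le
    have hm : m ≤ u.length := by omega
    obtain ⟨h1, h2⟩ := hu m (by omega) hm
    have hm1 : (1 : ℤ) ≤ m := by exact_mod_cast (by omega : 1 ≤ m)
    have hmi : (m : ℤ) ≤ i := by rw [← hi]; exact_mod_cast hm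
    rw [ones_append_right, hb]
    push_cast
    rw [hj]
    set s := ones u m
    have key : i * ((i + j) * (b + s - 1) - (j + m - 1) * (a + b)) =
        (i + j) * (i * s - (m - 1) * a - i) + i - (m - 1) := by
      linear_combination ((i : ℤ) - (m - 1)) * hdet
    have hj0 : 0 ≤ j := by rw [← hj]; positivity
    constructor
    · nlinarith
    · nlinarith
  · obtain ⟨h1, h2⟩ := hv n hn h
    have hn1 : (1 : ℤ) ≤ n := by exact_mod_cast hn
    have hnj : (n : ℤ) ≤ j := by rw [← hj]; exact_mod_cast h
    rw [ones_append_left h]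
    set s := ones v n
    have key : j * ((i + j) * (s - 1) - (n - 1) * (a + b)) =
        (i + j) * (j * (s - 1) - (n - 1) * b) + (n - 1) := by
      linear_combination ((n : ℤ) - 1) * hdet
    have hj0 : 0 < j := by linarith
    constructor
    · nlinarith
    · rcases h2.eq_or_lt with h0 | h0
      · have hd : j ∣ (n : ℤ) - 1 :=
          ⟨(s - 1) * i - a * (n - 1), by linear_combination (-((n : ℤ) - 1)) * hdet - i * h0⟩
        have : (n : ℤ) - 1 = 0 := Int.eq_zero_of_dvd_of_nonneg_of_lt (by linarith) (by linarith) hd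
        have hs : j * (s - 1) = 0 := by rw [this] at h0; linarith
        have hs : s - 1 = 0 := by rcases mul_eq_zero.1 hs with h | h; · omega
                                  · exact h
        rw [this, hs]; simp
      · nlinarith

/-- The arithmetic of the two words `substsWord d [0]`, `substsWord d [1]` of a node. -/
lemma node_arith (d : List Bool) :
    ((substsWord d [true]).count true : ℤ) * (substsWord d [false]).length -
      (substsWord d [false]).count true * (substsWord d [true]).length = 1 ∧
    IsUpper (substsWord d [false]) ((substsWord d [false]).count true)
      (substsWord d [false]).length ∧
    IsLower (substsWord d [true]) ((substsWord d [true]).count true)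
      (substsWord d [true]).length := by
  -- Appending a letter at the end of `d` replaces the word pair (U, V) by (U, VU) or (UV, V), to
  -- which the mediant lemmas apply; prepending would substitute inside both words.
  induction d using List.reverseRecOn with
  | nil =>
    refine ⟨by simp, ?_, ?_⟩
    · intro n h1 h2
      obtain rfl : n = 1 := by simp at h2; omega
      simp [ones]
    · intro n h1 h2
      obtain rfl : n = 1 := by simp at h2; omega
      simp [ones]
  | append_singleton d c ih =>
    have hu0 := length_le_length_substsWord d [false]
    have hv0 := length_le_length_substsWord d [true]
    obtain ⟨hdet, hu, hv⟩ := ih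
    simp only [substsWord_append]
    cases c with
    | false =>
      have e0 : substsWord [false] [false] = [false] := rfl
      have e1 : substsWord [false] [true] = [true, false] := rfl
      rw [e0, e1, substsWord_pair, List.count_append, List.length_append]
      refine ⟨by push_cast; linear_combination hdet, hu, ?_⟩
      have := IsLower.append rfl rfl rfl (by simpa [Nat.lt_iff_add_one_le] using hu0) hdet hu hv
      push_cast
      rwa [add_comm ((substsWord d [true]).count true : ℤ),
        add_comm ((substsWord d [true]).length : ℤ)]
    | true =>
      have e0 : substsWord [true] [false] = [false, true] := rfl
      have e1 : substsWord [true] [true] = [true] := rfl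
      rw [e0, e1, substsWord_pair, List.count_append, List.length_append]
      refine ⟨by push_cast; linear_combination hdet, ?_, hv⟩
      push_cast
      exact IsUpper.append rfl rfl rfl (by simpa [Nat.lt_iff_add_one_le] using hv0) hdet hu hv

/-- The length of the words of a node. -/
def nodeLength (d : List Bool) : ℕ := (substsWord d [false, true]).length

/-- The number of ones of the words of a node. -/
def nodeOnes (d : List Bool) : ℕ := (substsWord d [false, true]).count true

lemma nodeLength_eq (d : List Bool) :
    nodeLength d = (substsWord d [false]).length + (substsWord d [true]).length := by
  rw [nodeLength, substsWord_pair, List.length_append]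

lemma nodeOnes_eq (d : List Bool) :
    nodeOnes d = (substsWord d [false]).count true + (substsWord d [true]).count true := by
  rw [nodeOnes, substsWord_pair, List.count_append]

lemma length_node_true (d : List Bool) : (substsWord d [true, false]).length = nodeLength d := by
  rw [nodeLength_eq, substsWord_pair, List.length_append, add_comm]

lemma count_node_true (d : List Bool) : (substsWord d [true, false]).count true = nodeOnes d := by
  rw [nodeOnes_eq, substsWord_pair, List.count_append, add_comm]

lemma isUpper_node (d : List Bool) :
    IsUpper (substsWord d [false, true]) (nodeOnes d) (nodeLength d) := by
  obtain ⟨hdet, hu, hv⟩ := node_arith d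
  have hv0 := length_le_length_substsWord d [true]
  rw [nodeOnes_eq, nodeLength_eq, substsWord_pair]
  push_cast
  exact IsUpper.append rfl rfl rfl (by simpa [Nat.lt_iff_add_one_le] using hv0) hdet hu hv

lemma isLower_node (d : List Bool) :
    IsLower (substsWord d [true, false]) (nodeOnes d) (nodeLength d) := by
  obtain ⟨hdet, hu, hv⟩ := node_arith d
  have hu0 := length_le_length_substsWord d [false]
  rw [nodeOnes_eq, nodeLength_eq, substsWord_pair]
  push_cast
  exact IsLower.append rfl rfl rfl (by simpa [Nat.lt_iff_add_one_le] using hu0) hdet hu hv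

lemma coprime_node (d : List Bool) : Nat.Coprime (nodeOnes d) (nodeLength d) := by
  obtain ⟨hdet, -, -⟩ := node_arith d
  rw [← Nat.isCoprime_iff_coprime]
  refine ⟨(substsWord d [false]).length, -((substsWord d [false]).count true), ?_⟩
  rw [nodeOnes_eq, nodeLength_eq]
  push_cast
  linear_combination hdet

lemma head_substsWord (d : List Bool) (b : Bool) (w : List Bool) :
    (substsWord d (b :: w)).head? = some b := by
  induction d with
  | nil => rfl
  | cons c d ih =>
    obtain ⟨t, ht⟩ : ∃ t, substsWord d (b :: w) = b :: t := by
      cases h : substsWord d (b :: w) with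
      | nil => rw [h] at ih; simp at ih
      | cons e t => rw [h] at ih; simp at ih; exact ⟨t, by rw [ih]⟩
    rw [substsWord_cons, ht]
    simp only [substWord, List.flatMap_cons]
    split_ifs with h <;> simp [h]

lemma count_substWord (c : Bool) (w : List Bool) :
    (substWord c w).count c = w.length ∧ (substWord c w).count (!c) = w.count (!c) := by
  induction w with
  | nil => simp [substWord]
  | cons b w ih =>
    have e : substWord c (b :: w) = substWord c [b] ++ substWord c w := substWord_append c [b] w
    rw [e, List.count_append, List.count_append, ih.1, ih.2]
    cases b <;> cases c <;> simp [substWord] <;> omega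

/-- The Euclidean algorithm reaches every coprime pair of letter counts. -/
lemma exists_node (z o : ℕ) (hz : 0 < z) (ho : 0 < o) (h : Nat.Coprime z o) :
    ∃ d, (substsWord d [false, true]).count false = z ∧
      (substsWord d [false, true]).count true = o := by
  induction hn : z + o using Nat.strong_induction_on generalizing z o with
  | _ n ih =>
    -- One subtractive Euclidean step: `subst true` preserves the number of zeros and adds it to the
    -- number of ones, and `subst false` does the reverse.
    rcases lt_trichotomy z o with hlt | heq | hgt
    · obtain ⟨d, h1, h2⟩ := ih (z + (o - z)) (by omega) z (o - z) hz (by omega)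
        ((Nat.coprime_sub_self_right hlt.le).2 h) rfl
      refine ⟨true :: d, ?_, ?_⟩
      · rw [substsWord_cons, ← h1]; exact (count_substWord true _).2
      · rw [substsWord_cons, (count_substWord true _).1, ← List.count_false_add_count_true]
        omega
    · subst heq
      rw [Nat.coprime_self] at h
      subst h
      exact ⟨[], by simp, by simp⟩
    · obtain ⟨d, h1, h2⟩ := ih (z - o + o) (by omega) (z - o) o (by omega) ho
        ((Nat.coprime_sub_self_left hgt.le).2 h) rfl
      refine ⟨false :: d, ?_, ?_⟩
      · rw [substsWord_cons, (count_substWord false _).1, ← List.count_false_add_count_true]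
        omega
      · rw [substsWord_cons, ← h2]; exact (count_substWord false _).2

/-! ### Extremal cyclically balanced words -/

lemma ones_add (w : List Bool) (m k : ℕ) :
    ones w (m + k) = ones w m + ((w.drop m).take k).count true := by
  rw [ones, List.take_add, List.count_append]; push_cast; rfl

lemma ones_square_add {w : List Bool} {k : ℕ} (hk : k ≤ w.length) :
    ones (w ++ w) (w.length + k) = w.count true + ones (w ++ w) k := by
  rw [ones_append_right, ones_append_left hk]

/-- Discrepancies q·ones − n·p confined to a half-open window of length q give each factor a count
within less than 1 of its mean, so two counts for the same length differ by less than 2. -/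
lemma cyclicallyBalanced_of_window {w : List Bool} (hw : 0 < w.length) (m : ℤ)
    (h : ∀ n ≤ w.length, m ≤ w.length * ones w n - n * w.count true ∧
      w.length * ones w n - n * w.count true < m + w.length) : CyclicallyBalanced w := by
  have h2 : ∀ n ≤ 2 * w.length, m ≤ w.length * ones (w ++ w) n - n * w.count true ∧
      w.length * ones (w ++ w) n - n * w.count true < m + w.length := by
    intro n hn
    rcases Nat.lt_or_ge w.length n with h' | h'
    · obtain ⟨k, rfl⟩ := Nat.exists_eq_add_of_le h'.le
      have := h k (by omega)
      rw [ones_append_right]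
      push_cast
      constructor <;> linarith
    · rw [ones_append_left h']; exact h n h'
  have key : ∀ u : List Bool, u <:+: w ++ w →
      |(w.length : ℤ) * u.count true - u.length * w.count true| < w.length := by
    rintro u ⟨s, t, e⟩
    have hl := congrArg List.length e
    simp only [List.length_append] at hl
    have e1 : ones (w ++ w) s.length = s.count true := by
      rw [← e, List.append_assoc, ones_append_left le_rfl, ones_of_length_le le_rfl]
    have e2 : ones (w ++ w) (s.length + u.length) = s.count true + u.count true := by
      rw [← e, List.append_assoc, ones_append_right, ones_append_left le_rfl,
        ones_of_length_le le_rfl]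
    have a1 := h2 s.length (by omega)
    have a2 := h2 (s.length + u.length) (by omega)
    rw [e1] at a1
    rw [e2] at a2
    push_cast at a2
    rw [abs_lt]
    constructor <;> linarith
  intro u v hu hv huv
  have a1 := abs_lt.1 (key u hu)
  have a2 := abs_lt.1 (key v hv)
  rw [huv] at a1
  have hq : (0 : ℤ) < w.length := by exact_mod_cast hw
  have b1 : (w.length : ℤ) * (u.count true - v.count true) < w.length * 2 := by linarith
  have b2 : (w.length : ℤ) * (-2) < w.length * (u.count true - v.count true) := by linarith
  have c1 := lt_of_mul_lt_mul_left b1 hq.le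
  have c2 := lt_of_mul_lt_mul_left b2 hq.le
  rw [abs_le]
  constructor <;> linarith

/-- Each letter of the cyclic word lies in exactly k of the windows of length k. -/
lemma sum_ones_sub (w : List Bool) {k : ℕ} (hk : k ≤ w.length) :
    ∑ m ∈ Finset.range w.length, (ones (w ++ w) (m + k) - ones (w ++ w) m) =
      k * w.count true := by
  induction k with
  | zero => simp
  | succ k ih =>
    have h1 := Finset.sum_range_sub (fun m => ones (w ++ w) (m + k)) w.length
    rw [zero_add, ones_square_add (by omega), add_sub_cancel_right] at h1
    have h2 := ih (by omega)
    have h3 : ∑ m ∈ Finset.range w.length, (ones (w ++ w) (m + (k + 1)) - ones (w ++ w) m) =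
        ∑ m ∈ Finset.range w.length, (ones (w ++ w) (m + 1 + k) - ones (w ++ w) (m + k)) +
        ∑ m ∈ Finset.range w.length, (ones (w ++ w) (m + k) - ones (w ++ w) m) := by
      rw [← Finset.sum_add_distrib]
      refine Finset.sum_congr rfl fun m _ => ?_
      rw [show m + (k + 1) = m + 1 + k by omega]; ring
    rw [h3, h1, h2]
    push_cast; ring

/-- A factor of a cyclically balanced word has nearly the average number of ones. -/
lemma factor_count_bounds {w : List Bool} (hw : CyclicallyBalanced w) {k m : ℕ}
    (hk : k ≤ w.length) (hm : m < w.length) :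
    (w.length : ℤ) * (((w ++ w).drop m).take k).count true ≤
        k * w.count true + w.length - 1 ∧
      (k : ℤ) * w.count true - w.length + 1 ≤
        w.length * (((w ++ w).drop m).take k).count true := by
  set C : ℕ → ℤ := fun m => (((w ++ w).drop m).take k).count true with hC
  have hsum : ∑ m ∈ Finset.range w.length, C m = k * w.count true := by
    rw [← sum_ones_sub w hk]
    refine Finset.sum_congr rfl fun m _ => ?_
    rw [ones_add]; simp [hC]
  have hclose : ∀ n < w.length, |C m - C n| ≤ 1 := by
    intro n hn
    refine hw _ _ ?_ ?_ ?_
    · exact (List.take_prefix _ _).isInfix.trans (List.drop_suffix _ _).isInfix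
    · exact (List.take_prefix _ _).isInfix.trans (List.drop_suffix _ _).isInfix
    · simp only [List.length_take, List.length_drop, List.length_append]; omega
  -- All summands are nonnegative and the one at m equals 1; this unit is the −1 that sharpens the
  -- bound.
  have s1 := Finset.single_le_sum (f := fun n => C n - (C m - 1)) (s := Finset.range w.length)
    (fun n hn => by
      have := abs_le.1 (hclose n (Finset.mem_range.1 hn)); linarith)
    (Finset.mem_range.2 hm)
  have s2 := Finset.single_le_sum (f := fun n => (C m + 1) - C n) (s := Finset.range w.length)
    (fun n hn => by
      have := abs_le.1 (hclose n (Finset.mem_range.1 hn)); linarith)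
    (Finset.mem_range.2 hm)
  rw [Finset.sum_sub_distrib, hsum, Finset.sum_const, Finset.card_range, nsmul_eq_mul] at s1 s2
  change (w.length : ℤ) * C m ≤ _ ∧ _ ≤ (w.length : ℤ) * C m
  constructor <;> linarith

/-- Apply the factor bounds to the factor that follows the first letter: the known letter is removed
and n − 1 letters remain. -/
lemma prefix_count_bounds {w : List Bool} {b : Bool} (hw : CyclicallyBalanced w)
    (hb : w.head? = some b) (h2 : 2 ≤ w.length) {n : ℕ} (hn : 1 ≤ n) (hn' : n ≤ w.length) :
    w.length * (ones w n - (if b then 1 else 0)) ≤ (n - 1) * w.count true + w.length - 1 ∧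
      (n - 1 : ℤ) * w.count true - w.length + 1 ≤
        w.length * (ones w n - (if b then 1 else 0)) := by
  obtain ⟨k, rfl⟩ := Nat.exists_eq_add_of_le hn
  have := factor_count_bounds hw (k := k) (m := 1) (by omega) (by omega)
  have e : ones w (1 + k) - (if b then 1 else 0) = (((w ++ w).drop 1).take k).count true := by
    rw [← ones_append_left (v := w) hn', ones_add]
    have : ones (w ++ w) 1 = if b then 1 else 0 := by
      cases w with
      | nil => simp at h2
      | cons c t =>
        simp only [List.head?_cons, Option.some.injEq] at hb
        subst hb
        cases c <;> simp [ones]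
    rw [this]; ring
  rw [e]
  push_cast
  simpa using this

lemma le_of_ones_le {u v : List Bool} (hl : u.length = v.length)
    (h : ∀ n ≤ u.length, ones u n ≤ ones v n) : u ≤ v := by
  rw [← not_lt]
  induction u generalizing v with
  | nil =>
    obtain rfl : v = [] := by simpa using hl.symm
    simp
  | cons b u ih =>
    cases v with
    | nil => simp at hl
    | cons c v =>
      have h1 := h 1 (by simp)
      intro hlt
      rcases List.cons_lt_cons_iff.1 hlt with h' | ⟨rfl, h'⟩
      · rw [Bool.lt_iff] at h'
        rw [h'.1, h'.2] at h1
        simp [ones] at h1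
      · refine ih (by simpa using hl) (fun n hn => ?_) h'
        have := h (n + 1) (by simpa using hn)
        simp only [ones, List.take_succ_cons, List.count_cons] at this
        simp only [ones]
        push_cast at this
        linarith

/-! ### Identification of the nodes with the rational slopes -/

lemma nodeOnes_pos (d : List Bool) : 0 < nodeOnes d := by
  rw [← count_node_true, List.count_pos_iff]
  exact List.mem_of_mem_head? (head_substsWord d true [false])

lemma nodeOnes_lt (d : List Bool) : nodeOnes d < nodeLength d := by
  have h : 0 < (substsWord d [false, true]).count false := by
    rw [List.count_pos_iff]
    exact List.mem_of_mem_head? (head_substsWord d false [true])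
  have := List.count_false_add_count_true (substsWord d [false, true])
  rw [nodeOnes, nodeLength]
  omega

/-- The proportion of ones in the words of a node. -/
def ratio (d : List Bool) : ℚ := nodeOnes d / nodeLength d

lemma ratio_den (d : List Bool) : (ratio d).den = nodeLength d := by
  have h := Rat.den_div_eq_of_coprime (a := nodeOnes d) (b := nodeLength d)
    (by exact_mod_cast (nodeOnes_pos d).trans (nodeOnes_lt d)) (by simpa using coprime_node d)
  rw [Int.cast_natCast, Int.cast_natCast] at h
  exact Int.ofNat_inj.1 h

lemma ratio_mem (d : List Bool) : ratio d ∈ Ioo (0 : ℚ) 1 := by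
  have h1 : (0 : ℚ) < nodeOnes d := by exact_mod_cast nodeOnes_pos d
  have h2 : (nodeOnes d : ℚ) < nodeLength d := by exact_mod_cast nodeOnes_lt d
  exact ⟨div_pos h1 (h1.trans h2), (div_lt_one (h1.trans h2)).2 h2⟩

lemma exists_ratio {r : ℚ} (hr : r ∈ Ioo (0 : ℚ) 1) : ∃ d, ratio d = r := by
  obtain ⟨h0, h1⟩ := hr
  have hn : 0 < r.num := Rat.num_pos.2 h0
  have hlt : r.num < r.den := by
    have h := Rat.num_div_den r
    rw [← h, div_lt_one (by exact_mod_cast r.pos)] at h1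
    exact_mod_cast h1
  obtain ⟨o, ho⟩ := Int.eq_ofNat_of_zero_le hn.le
  have hco : Nat.Coprime o r.den := by have := r.reduced; rwa [ho, Int.natAbs_natCast] at this
  rw [ho] at hn hlt
  have hn' : 0 < o := by exact_mod_cast hn
  have hlt' : o < r.den := by exact_mod_cast hlt
  obtain ⟨d, hz, hd⟩ := exists_node (r.den - o) o (by omega) hn'
    ((Nat.coprime_sub_self_left hlt'.le).2 hco.symm)
  refine ⟨d, ?_⟩
  have hl : nodeLength d = r.den := by
    rw [nodeLength, ← List.count_false_add_count_true, hz, hd]; omega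
  rw [ratio, hl, nodeOnes, hd]
  conv_rhs => rw [← Rat.num_div_den r, ho]
  rfl

lemma mem_ratioWords_iff {d w : List Bool} {c : Bool} :
    w ∈ ratioWords (ratio d) c ↔ w.length = nodeLength d ∧ w.count true = nodeOnes d ∧
      CyclicallyBalanced w ∧ w.head? = some c := by
  simp only [ratioWords, mem_ofPred_eq, ratio_den]
  refine and_congr_right fun hl => and_congr_left fun _ => ?_
  have hq : (nodeLength d : ℚ) ≠ 0 := by
    exact_mod_cast ((nodeOnes_pos d).trans (nodeOnes_lt d)).ne'
  rw [hl, ratio, div_left_inj' hq, Nat.cast_inj]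

/-- The prefix counts of the node word equal ⌈(n−1)p/q⌉, the largest that balance allows after an
initial 0, and domination of all prefix counts implies lexicographic domination. -/
lemma isGreatest_node (d : List Bool) :
    IsGreatest (ratioWords (ratio d) false) (substsWord d [false, true]) := by
  have hp := nodeOnes_pos d
  have hpq := nodeOnes_lt d
  have hp' : (0 : ℤ) < nodeOnes d := by exact_mod_cast hp
  have hpq' : (nodeOnes d : ℤ) < nodeLength d := by exact_mod_cast hpq
  have hup := isUpper_node d
  have hL : (substsWord d [false, true]).length = nodeLength d := rfl
  have hC : (substsWord d [false, true]).count true = nodeOnes d := rfl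
  constructor
  · rw [mem_ratioWords_iff]
    refine ⟨rfl, rfl, ?_, head_substsWord _ _ _⟩
    refine cyclicallyBalanced_of_window (by omega) (-(nodeOnes d)) fun n hn => ?_
    rw [hL, hC]
    rcases Nat.eq_zero_or_pos n with rfl | h
    · simp; omega
    · have := hup n h hn
      constructor <;> linarith
  · intro w hw
    rw [mem_ratioWords_iff] at hw
    obtain ⟨h1, h2, h3, h4⟩ := hw
    refine le_of_ones_le (by rw [h1, hL]) fun n hn => ?_
    rcases Nat.eq_zero_or_pos n with rfl | h
    · simp
    · have a := (prefix_count_bounds h3 h4 (by omega) h hn).1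
      have b := (hup n h (by omega)).1
      rw [h1, h2] at a
      simp only [Bool.false_eq_true, if_false, sub_zero] at a
      have : (nodeLength d : ℤ) * ones w n <
          nodeLength d * (ones (substsWord d [false, true]) n + 1) := by linarith
      exact Int.lt_add_one_iff.1 (lt_of_mul_lt_mul_left this (by omega))

lemma isLeast_node (d : List Bool) :
    IsLeast (ratioWords (ratio d) true) (substsWord d [true, false]) := by
  have hp := nodeOnes_pos d
  have hpq := nodeOnes_lt d
  have hp' : (0 : ℤ) < nodeOnes d := by exact_mod_cast hp
  have hpq' : (nodeOnes d : ℤ) < nodeLength d := by exact_mod_cast hpq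
  have hlow := isLower_node d
  have hL := length_node_true d
  have hC := count_node_true d
  constructor
  · rw [mem_ratioWords_iff]
    refine ⟨hL, hC, ?_, head_substsWord _ _ _⟩
    refine cyclicallyBalanced_of_window (by omega) (-(nodeOnes d) + 1) fun n hn => ?_
    rw [hL, hC]
    rcases Nat.eq_zero_or_pos n with rfl | h
    · simp; omega
    · have := hlow n h hn
      constructor <;> linarith
  · intro w hw
    rw [mem_ratioWords_iff] at hw
    obtain ⟨h1, h2, h3, h4⟩ := hw
    refine le_of_ones_le (by rw [h1, hL]) fun n hn => ?_
    rcases Nat.eq_zero_or_pos n with rfl | h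
    · simp
    · have a := (prefix_count_bounds h3 h4 (by omega) h (by omega)).2
      have b := (hlow n h hn).2
      rw [h1, h2] at a
      simp only [if_true] at a
      have : (nodeLength d : ℤ) * ones (substsWord d [true, false]) n <
          nodeLength d * (ones w n + 1) := by linarith
      exact Int.lt_add_one_iff.1 (lt_of_mul_lt_mul_left this (by omega))

lemma omegaMinus_ratio (d : List Bool) : omegaMinus (ratio d) = substsWord d [false, true] :=
  (Classical.epsilon_spec (p := fun w => IsGreatest (ratioWords (ratio d) false) w)
    ⟨_, isGreatest_node d⟩).unique (isGreatest_node d)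

lemma omegaPlus_ratio (d : List Bool) : omegaPlus (ratio d) = substsWord d [true, false] :=
  (Classical.epsilon_spec (p := fun w => IsLeast (ratioWords (ratio d) true) w)
    ⟨_, isLeast_node d⟩).unique (isLeast_node d)

lemma Delta_ratio (d : List Bool) : Delta (ratio d) =
    Icc (value (substs d (alt false)))
      (value (substs d (cons false (cons true (alt true))))) := by
  have e0 := periodic_substsWord d false
  have e1 := periodic_substsWord d true
  simp only [Bool.not_false, Bool.not_true] at e0 e1
  rw [Delta, omegaMinus_ratio, omegaPlus_ratio, e0, e1, ← substs_concat]
  simp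

/-! ### The gaps between the intervals of the nodes -/

/-- `a` lies in the open gap of the node `d`. -/
def InGap (d : List Bool) (a : ℝ) : Prop :=
  value (substs d (cons false (cons true (rep false)))) < a ∧
    a < value (substs d (cons false (rep true)))

/-- The endpoints match because `subst false` sends 1^∞ to (10)^∞ and `subst true` sends 0^∞ to
(01)^∞: the left child's gap ends where Δ begins, and the right child's gap begins where Δ ends. -/
lemma InGap.child {d : List Bool} {a : ℝ} (h : InGap d a) (ha : a ∉ Delta (ratio d)) :
    ∃ c, InGap (d ++ [c]) a := by
  have e0 : subst false (rep true) = alt true := subst_rep_not false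
  have e1 : subst true (rep false) = alt false := subst_rep_not true
  rw [Delta_ratio, mem_Icc, not_and_or, not_le, not_le] at ha
  rcases ha with ha | ha
  · refine ⟨false, ?_, ?_⟩
    · rw [substs_append, substs_cons, substs_nil, subst_cons_self, subst_false_cons_true,
        subst_rep, ← rep_eq_cons]
      exact h.1
    · rw [substs_append, substs_cons, substs_nil, subst_cons_self, e0]
      rwa [alt_eq_cons] at ha
  · refine ⟨true, ?_, ?_⟩
    · rw [substs_append, substs_cons, substs_nil, subst_true_cons_false, subst_cons_self, e1]
      rwa [alt_eq_cons true] at ha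
    · rw [substs_append, substs_cons, substs_nil, subst_true_cons_false, subst_rep,
        ← rep_eq_cons]
      exact h.2

lemma length_child (d : List Bool) (c : Bool) :
    ((substsWord (d ++ [c]) [false]).length, (substsWord (d ++ [c]) [true]).length) =
      if c then ((substsWord d [false]).length + (substsWord d [true]).length,
        (substsWord d [true]).length)
      else ((substsWord d [false]).length,
        (substsWord d [false]).length + (substsWord d [true]).length) := by
  cases c
  · have e0 : substsWord [false] [false] = [false] := rfl
    have e1 : substsWord [false] [true] = [true, false] := rfl
    rw [substsWord_append, substsWord_append, e0, e1, substsWord_pair, List.length_append]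
    simp [add_comm]
  · have e0 : substsWord [true] [false] = [false, true] := rfl
    have e1 : substsWord [true] [true] = [true] := rfl
    rw [substsWord_append, substsWord_append, e0, e1, substsWord_pair, List.length_append]
    simp

lemma length_pos (d : List Bool) (b : Bool) : 0 < (substsWord d [b]).length :=
  length_le_length_substsWord d [b]

/-- The children of lengths (u, v) have lengths (u, u+v) and (u+v, v), so comparing the two entries
recovers the last letter of the node. -/
lemma node_injective {d e : List Bool}
    (h0 : (substsWord d [false]).length = (substsWord e [false]).length)
    (h1 : (substsWord d [true]).length = (substsWord e [true]).length) : d = e := by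
  induction d using List.reverseRecOn generalizing e with
  | nil =>
    rcases List.eq_nil_or_concat' e with rfl | ⟨e, c, rfl⟩
    · rfl
    · have h := length_child e c
      rw [← h0, ← h1] at h
      have := length_pos e false
      have := length_pos e true
      cases c <;> simp at h <;> omega
  | append_singleton d b ih =>
    have hd := length_child d b
    have := length_pos d false
    have := length_pos d true
    rcases List.eq_nil_or_concat' e with rfl | ⟨e, c, rfl⟩
    · rw [h0, h1] at hd
      cases b <;> simp at hd <;> omega
    · have h := length_child e c
      have := length_pos e false
      have := length_pos e true
      rw [← h0, ← h1, hd] at h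
      cases b <;> cases c <;> simp at h
      · rw [ih h.1 (by omega)]
      · omega
      · omega
      · rw [ih (by omega) h.2]

lemma nodeLength_child (d : List Bool) (c : Bool) :
    nodeLength d + 1 ≤ nodeLength (d ++ [c]) ∧ nodeLength (d ++ [c]) ≤ 2 * nodeLength d := by
  have h := length_child d c
  have := length_pos d false
  have := length_pos d true
  rw [nodeLength_eq, nodeLength_eq]
  cases c <;> simp only [Bool.false_eq_true, if_true, if_false, Prod.mk.injEq] at h <;>
    constructor <;> omega

lemma inGap_nil {a : ℝ} (ha : a ∈ Ioo (1 / 4 : ℝ) (1 / 2)) : InGap [] a := by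
  constructor
  · rw [substs_nil, value_cons_false, value_cons_true, value_rep_false]; linarith [ha.1]
  · rw [substs_nil, value_cons_false, value_rep_true]; linarith [ha.2]

/-- Along a branch the word length strictly increases and at most doubles, so it cannot jump over
the range from N to 2N. -/
lemma exists_inGap {a : ℝ} (ha : a ∈ exceptionalSet) {N : ℕ} (hN : 2 ≤ N) :
    ∃ d, N ≤ nodeLength d ∧ nodeLength d ≤ 2 * N ∧ InGap d a := by
  induction N, hN using Nat.le_induction with
  | base => exact ⟨[], by simp [nodeLength], by simp [nodeLength], inGap_nil ha.1⟩
  | succ N hN ih =>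
    obtain ⟨d, h1, h2, h3⟩ := ih
    rcases h1.eq_or_lt with h | h
    · obtain ⟨c, hc⟩ := h3.child fun hmem =>
        ha.2 (mem_iUnion₂.2 ⟨ratio d, ratio_mem d, hmem⟩)
      have := nodeLength_child d c
      exact ⟨d ++ [c], by omega, by omega, hc⟩
    · exact ⟨d, by omega, by omega, h3⟩

lemma abs_value_substs_sub_le (d : List Bool) (b : Bool) (x y : ℕ → Bool) :
    |value (substs d (cons b (cons (!b) x))) - value (substs d (cons b (cons (!b) y)))| ≤
      1 / 2 ^ nodeLength d := by
  have h := abs_value_concat_sub_le (substsWord d [b, !b]) (substs d x) (substs d y)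
  have hl : (substsWord d [b, !b]).length = nodeLength d := by
    cases b
    · rfl
    · exact length_node_true d
  rw [← substs_concat, ← substs_concat, hl] at h
  simpa using h

/-! ### Equality of `phi` and `chi` on the exceptional set -/

lemma substs_replicate_rep_true (n : ℕ) :
    ∃ y, substs (List.replicate n false) (rep true) =
      concat (true :: List.replicate n false) y := by
  induction n with
  | zero => exact ⟨rep true, by simpa using rep_eq_cons true⟩
  | succ n ih =>
    obtain ⟨y, hy⟩ := ih
    refine ⟨subst false y, ?_⟩
    rw [List.replicate_succ, substs_cons, hy, subst_concat]
    congr 1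
    have : ∀ n, substWord false (List.replicate n false) = List.replicate n false := by
      intro n
      induction n with
      | zero => rfl
      | succ n ih => rw [List.replicate_succ, ← List.singleton_append, substWord_append, ih]; rfl
    rw [← List.singleton_append, substWord_append, this]
    rfl

lemma concat_replicate_rep (n : ℕ) (b : Bool) : concat (List.replicate n b) (rep b) = rep b := by
  induction n with
  | zero => simp
  | succ n ih => rw [List.replicate_succ, concat_cons, ih, ← rep_eq_cons]

lemma substs_replicate_one_zeros (n : ℕ) :
    substs (List.replicate n false) (cons true (rep false)) = cons true (rep false) := by
  induction n with
  | zero => rfl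
  | succ n ih =>
    rw [List.replicate_succ, substs_cons, ih, subst_false_cons_true, subst_rep, ← rep_eq_cons]

lemma substs_replicate_zero (n : ℕ) (x : ℕ → Bool) :
    substs (List.replicate n false) (cons false x) =
      cons false (substs (List.replicate n false) x) := by
  induction n with
  | zero => rfl
  | succ n ih => rw [List.replicate_succ, substs_cons, ih, subst_cons_self, substs_cons]

/-- Descend n times to the left. The left end σ(0·(10^n)^∞) needed for uncountability tends to
σ(010^∞) < a, while the right end σ(10^∞) does not change. -/
lemma InGap.le_chi {d : List Bool} {a : ℝ} (h : InGap d a) (ha : a < 1 / 2) :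
    value (substs d (cons true (rep false))) ≤ chi a := by
  obtain ⟨n, hn⟩ := exists_pow_lt_of_lt_one (sub_pos.2 h.1) (by norm_num : (1 / 2 : ℝ) < 1)
  have key := DoublingHole.le_chi (d ++ List.replicate n false) ha ?_
  · rwa [substs_append, substs_replicate_one_zeros] at key
  obtain ⟨y, hy⟩ := substs_replicate_rep_true n
  rw [substs_append, substs_replicate_zero, hy, ← concat_cons]
  have e : cons false (cons true (rep false)) =
      concat (false :: true :: List.replicate n false) (rep false) := by
    rw [concat_cons, concat_cons, concat_replicate_rep]
  rw [e, substs_concat] at hn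
  rw [substs_concat]
  have h1 := abs_value_concat_sub_le (substsWord d (false :: true :: List.replicate n false))
    (substs d y) (substs d (rep false))
  have h2 := length_le_length_substsWord d (false :: true :: List.replicate n false)
  simp only [List.length_cons, List.length_replicate] at h2
  have h3 : (1 : ℝ) / 2 ^ (substsWord d (false :: true :: List.replicate n false)).length ≤
      (1 / 2) ^ n := by
    rw [one_div_pow]
    exact one_div_le_one_div_of_le (by positivity) (pow_le_pow_right₀ (by norm_num) (by omega))
  have h4 := (abs_le.1 (h1.trans h3)).2
  linarith

lemma phi_eq_chi {a : ℝ} (ha : a ∈ exceptionalSet) : phi a = chi a := by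
  have ha0 : 0 < a := by linarith [ha.1.1]
  have ha2 := ha.1.2
  refine le_antisymm ?_ (chi_le_phi ha0)
  have lim := tendsto_pow_atTop_nhds_zero_of_lt_one (r := (1 / 2 : ℝ)) (by norm_num) (by norm_num)
  have hle : ∀ᶠ N : ℕ in atTop, phi a - chi a ≤ (1 / 2) ^ N := by
    filter_upwards [eventually_ge_atTop 2] with N hN
    obtain ⟨d, h1, -, h3⟩ := exists_inGap ha hN
    have a1 := h3.le_chi ha2
    have a2 := phi_le d ha0 ha2 h3.2
    have a3 := (abs_le.1 (abs_value_substs_sub_le d true (rep true) (rep false))).2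
    rw [Bool.not_true, ← rep_eq_cons] at a3
    have a4 : (1 : ℝ) / 2 ^ nodeLength d ≤ (1 / 2) ^ N := by
      rw [one_div_pow]
      exact one_div_le_one_div_of_le (by positivity) (pow_le_pow_right₀ (by norm_num) h1)
    linarith
  linarith [ge_of_tendsto lim hle]

/-! ### The dimension of the exceptional set -/

lemma tendsto_count_mul_diam {s : ℝ} (hs : 0 < s) :
    Tendsto (fun N : ℕ => ∑ _p : Fin (2 * N + 1) × Fin (2 * N + 1),
      (ENNReal.ofReal ((1 / 2) ^ N)) ^ s) atTop (𝓝 0) := by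
  set ρ : ℝ := (1 / 2) ^ s with hρ
  have hρ0 : 0 < ρ := by positivity
  have hρ1 : ρ < 1 := Real.rpow_lt_one (by norm_num) (by norm_num) hs
  have e : ∀ N : ℕ, ∑ _p : Fin (2 * N + 1) × Fin (2 * N + 1),
      (ENNReal.ofReal ((1 / 2) ^ N)) ^ s = ENNReal.ofReal ((2 * N + 1) ^ 2 * ρ ^ N) := by
    intro N
    rw [Finset.sum_const, Finset.card_univ, Fintype.card_prod, Fintype.card_fin, nsmul_eq_mul,
      ENNReal.ofReal_rpow_of_pos (by positivity), ENNReal.ofReal_mul (by positivity)]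
    congr 1
    · rw [← ENNReal.ofReal_natCast]; push_cast; ring_nf
    · rw [hρ, ← Real.rpow_natCast, ← Real.rpow_natCast, ← Real.rpow_mul (by norm_num),
        ← Real.rpow_mul (by norm_num), mul_comm]
  simp_rw [e]
  rw [← ENNReal.ofReal_zero]
  refine ENNReal.tendsto_ofReal ?_
  have habs : |ρ| < 1 := by rwa [abs_of_pos hρ0]
  have h2 := tendsto_pow_const_mul_const_pow_of_abs_lt_one 2 habs
  have h1 := tendsto_pow_const_mul_const_pow_of_abs_lt_one 1 habs
  have h0 := tendsto_pow_const_mul_const_pow_of_abs_lt_one 0 habs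
  have := ((h2.const_mul 4).add (h1.const_mul 4)).add h0
  simp only [mul_zero, add_zero] at this
  refine this.congr fun N => ?_
  ring

lemma dimH_exceptionalSet : dimH exceptionalSet = 0 := by
  have key : ∀ s : NNReal, 0 < s → dimH exceptionalSet ≤ s := by
    intro s hs
    apply dimH_le_of_hausdorffMeasure_ne_top
    -- The covering sets are indexed by the pair of word lengths; as this pair determines the node,
    -- each set lies in a single gap.
    let t : (N : ℕ) → Fin (2 * N + 1) × Fin (2 * N + 1) → Set ℝ := fun N p =>
      {a | ∃ d, (substsWord d [false]).length = p.1 ∧ (substsWord d [true]).length = p.2 ∧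
        N ≤ nodeLength d ∧ InGap d a}
    have hdiam : ∀ N p, Metric.ediam (t N p) ≤ ENNReal.ofReal ((1 / 2) ^ N) := by
      intro N p
      apply Metric.ediam_le
      rintro x ⟨d, h0, h1, hN, hx⟩ y ⟨e, h0', h1', -, hy⟩
      obtain rfl : d = e := node_injective (h0.trans h0'.symm) (h1.trans h1'.symm)
      rw [edist_dist]
      apply ENNReal.ofReal_le_ofReal
      have a1 := (abs_le.1 (abs_value_substs_sub_le d false (rep true) (rep false))).2
      rw [Bool.not_false, ← rep_eq_cons] at a1
      have a2 : (1 : ℝ) / 2 ^ nodeLength d ≤ (1 / 2) ^ N := by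
        rw [one_div_pow]
        exact one_div_le_one_div_of_le (by positivity) (pow_le_pow_right₀ (by norm_num) hN)
      obtain ⟨x1, x2⟩ := hx
      obtain ⟨y1, y2⟩ := hy
      rw [Real.dist_eq, abs_le]
      constructor <;> linarith
    have hr : Tendsto (fun N : ℕ => ENNReal.ofReal ((1 / 2 : ℝ) ^ N)) atTop (𝓝 0) := by
      rw [← ENNReal.ofReal_zero]
      exact ENNReal.tendsto_ofReal
        (tendsto_pow_atTop_nhds_zero_of_lt_one (by norm_num) (by norm_num))
    have hle := MeasureTheory.Measure.hausdorffMeasure_le_liminf_sum (s : ℝ) exceptionalSet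
      _ hr t (Eventually.of_forall hdiam) (by
        filter_upwards [eventually_ge_atTop 2] with N hN a ha
        obtain ⟨d, h1, h2, h3⟩ := exists_inGap ha hN
        have := nodeLength_eq d
        exact mem_iUnion.2 ⟨(⟨(substsWord d [false]).length, by omega⟩,
          ⟨(substsWord d [true]).length, by omega⟩), d, rfl, rfl, h1, h3⟩)
    have hlim := (tendsto_count_mul_diam (s := s) (by exact_mod_cast hs)).liminf_eq
    have hle2 : liminf (fun N : ℕ => ∑ p, Metric.ediam (t N p) ^ (s : ℝ)) atTop ≤ 0 := by
      rw [← hlim]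
      refine liminf_le_liminf (Eventually.of_forall fun N => ?_)
      exact Finset.sum_le_sum fun p _ => ENNReal.rpow_le_rpow (hdiam N p) s.coe_nonneg
    exact ne_top_of_le_ne_top ENNReal.zero_ne_top (hle.trans hle2)
  refine le_antisymm ?_ bot_le
  refine ENNReal.le_of_forall_pos_le_add fun ε hε _ => ?_
  rw [zero_add]
  exact key ε hε

end DoublingHole

theorem mainTheorem10 :
    (∀ a : ℝ, a ∈ Set.Ioo (1 / 4 : ℝ) (1 / 2) →
      (DoublingHole.phi a = DoublingHole.chi a ↔ a ∈ DoublingHole.exceptionalSet)) ∧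
    dimH DoublingHole.exceptionalSet = 0 := by
  refine ⟨fun a ha => ⟨fun h => ⟨ha, fun hmem => ?_⟩, DoublingHole.phi_eq_chi⟩,
    DoublingHole.dimH_exceptionalSet⟩
  obtain ⟨r, hr, har⟩ := Set.mem_iUnion₂.1 hmem
  -- Every rational slope belongs to a node, so a point of Δ(r) falls under the strict inequality at
  -- that node.
  obtain ⟨d, rfl⟩ := DoublingHole.exists_ratio hr
  rw [DoublingHole.Delta_ratio] at har
  exact (DoublingHole.chi_lt_phi d ha.2 har.1 har.2).ne' h
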